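/- **Setting.** Fix $K\ge 1$ and a symmetric matrix $\Lambda\in(0,1)^{K\times K}$ (not depending on $n$) with $\Lambda_{k,k}\ne\Lambda_{k,\ell}$ for all $k\neq \ell$. For each $n$ let $b=b_n:V=[n]\to[K]$ be a block membership function with blocks $V_k=b^{-1}(k)$, $n_k=|V_k|$, and let $m=m(n)\le n$. Let $G$ be a random graph on $V$ with independent edges, $\{u,v\}$ being an edge with probability $\Lambda_{b(u),b(v)}$; let $A$ be its adjacency matrix. Independently of $G$, let the seed set $S\subseteq V$ be uniform among the $m$-subsets of $V$. Put $U=V\setminus S$, $S_k=S\cap V_k$, $m_k=|S_k|$, $U_1=U\cap V_1$, $\mathfrak u_1=|U_1|$. The graph, $S$ and $b|_S$ are observed. A nomination list is an ordering $\mathcal L:U\to\{1,\dots,|U|\}$ (a bijection), and $$\operatorname{AP}(\mathcal L)=\frac1{\mathfrak u_1}\sum_{i=1}^{\mathfrak u_1}\frac{|\{j\le i:\mathcal L^{-1}(j)\in U_1\}|}{i}.$$ (When $\mathfrak u_1=0$, $\operatorname{AP}$ is set to $0$.) For a vector $N$ of block sizes let $\mathcal B(N)$ be the set of $\phi:V\to[K]$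 with $|\phi^{-1}(k)|=N_k$ for all $k$ and $\phi=b$ on $S$. **Canonical scheme $\mathcal L^{C}$.** It lists the vertices $v\in U$ in decreasing order of $$\frac{\sum_{\phi\in\mathcal B(n_1,\dots,n_K),\,\phi(v)=1}\mathbb P_\phi(G)}{\sum_{\phi\in\mathcal B(n_1,\dots,n_K)}\mathbb P_\phi(G)},$$ where $\mathbb P_\phi(G)$ is the probability of the observed graph under the block model with membership function $\phi$ and matrix $\Lambda$; ties are broken uniformly at random. **Restricted-focus maximum likelihood scheme $\mathcal L^{\mathrm{ML}}_R$ with estimated parameters.** Let $\widehat\Lambda_{k,\ell}$ be the number of edges between $S_k$ and $S_\ell$ divided by $m_km_\ell$ if $k\ne\ell$, and the number of edges within $S_k$ divided by $\binom{m_k}2$ if $k=\ell$. Let $\hat n=(\hat n_k)_k$ be obtained from $(m_kn/m)_k$ by rounding each entry to an integer at distance less than $1$ so that $\sum_k\hat n_k=n$. Let $\phi$ be any maximizer over $\mathcal B(\hat n)$ of $$\sum_{i\in S}\sum_{j\in U}A_{i,j}\log\frac{\widehat\Lambda_{b(i),\phi(j)}}{1-\widehat\Lambda_{b(i),\phi(j)}}$$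 (if some $\widehat\Lambda_{k,\ell}$ is undefined or not in $(0,1)$, let $\phi$ be arbitrary). For $\psi:V\to[K]$ put $\ell_R(\psi)=\prod_{i\in S}\prod_{j\in U}\widehat\Lambda_{b(i),\psi(j)}^{A_{i,j}}(1-\widehat\Lambda_{b(i),\psi(j)})^{1-A_{i,j}}$ and let $\phi_{i\leftrightarrow j}$ be $\phi$ with the values at $i$ and $j$ exchanged. For $i\in U$ let $\tilde\eta(i)$ (if $\phi(i)=1$) be the geometric mean of $\ell_R(\phi_{i\leftrightarrow j})/\ell_R(\phi)$ over $j\in U$ with $\phi(j)\ne1$, and let $\tilde\xi(i)$ (if $\phi(i)\neq1$) be the geometric mean of the same ratios over $j\in U$ with $\phi(j)=1$. The list consists first of the vertices of $U$ with $\phi=1$ in increasing order of $\tilde\eta$, then of the other vertices of $U$ in decreasing order of $\tilde\xi$, ties being broken uniformly at random. **Theorem.** Suppose that $n_k=\Theta(n)$ for every $k$ and that, for every $C>0$, as $n\to\infty$, $\mathbb P(m_k\ge C n^{2/3}\log n)\to1$ for each $k\neq1$ and $\mathbb P(m_1\ge Cn^{4/5})\to1$ (that is, $m_k=\omega(n^{2/3}\log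 n)$ and $m_1=\omega(n^{4/5})$ with probability tending to one). Suppose also that $\mathbb P(U_1\ne\emptyset)\to1$. Then, for every choice of the roundings $\hat n$ and of the maximizers $\phi$, $$\lim_{n\to\infty}\mathbb E\operatorname{AP}(\mathcal L^{\mathrm{ML}}_R)=1,$$ and $\mathcal L^{\mathrm{ML}}_R$ is consistent, i.e. $\lim_{n\to\infty}|\mathbb E\operatorname{AP}(\mathcal L^{C})-\mathbb E\operatorname{AP}(\mathcal L^{\mathrm{ML}}_R)|=0$. Expectations are over $G$, $S$ and the random tie-breaking. -/

import Mathlib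

open Filter Topology Asymptotics

noncomputable section

namespace VertexNomination

variable {n K : ℕ}

/-! ### The stochastic block model with vertex set `Fin n` and a uniformly random seed set

Blocks are indexed by `Fin K`; the block of interest (block `1` of `[K]`) is `0 : Fin K`. -/

/-- `|V_k|`, the number of vertices that `b` assigns to block `k`. -/
def blockSize (b : Fin n → Fin K) (k : Fin K) : ℕ :=
  (Finset.univ.filter fun v => b v = k).card

open Classical in
/-- The probability of the graph `G` under the conditional stochastic block model with block
membership function `b` and block probability matrix `Λ`: independently for every unordered pair
`{i, j}`, there is an edge with probability `Λ (b i) (b j)`. As a function of `b`, this is the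
likelihood of `b`. -/
def sbmProb (Λ : Matrix (Fin K) (Fin K) ℝ) (b : Fin n → Fin K) (G : SimpleGraph (Fin n)) : ℝ :=
  ∏ p ∈ Finset.univ.filter fun p : Fin n × Fin n => p.1 < p.2,
    if G.Adj p.1 p.2 then Λ (b p.1) (b p.2) else 1 - Λ (b p.1) (b p.2)

open Classical in
/-- The probability of the event `E` when the seed set is uniform among the `m`-subsets. -/
def seedProb (n m : ℕ) (E : Finset (Fin n) → Prop) : ℝ :=
  (((Finset.powersetCard m (Finset.univ : Finset (Fin n))).filter E).card : ℝ) / (n.choose m : ℝ)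

open Classical in
/-- The expectation of `f G S` when `G` is drawn from the block model and, independently,
the seed set `S` is uniform among the `m`-subsets of the vertex set. -/
def expectation (Λ : Matrix (Fin K) (Fin K) ℝ) (b : Fin n → Fin K) (m : ℕ)
    (f : SimpleGraph (Fin n) → Finset (Fin n) → ℝ) : ℝ :=
  ∑ G : SimpleGraph (Fin n), ∑ S ∈ Finset.powersetCard m (Finset.univ : Finset (Fin n)),
    sbmProb Λ b G * (1 / (n.choose m : ℝ)) * f G S

/-- `m_k = |S_k|`, the number of seeds in block `k`. -/
def seedCount (b : Fin n → Fin K) (S : Finset (Fin n)) (k : Fin K) : ℕ :=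
  (S.filter fun v => b v = k).card

/-! ### Nomination lists and average precision -/

/-- A nomination list: an ordering of the nonseed vertices. Ranks start at `0`. -/
abbrev NominationList (S : Finset (Fin n)) : Type :=
  {v : Fin n // v ∉ S} ≃ Fin (Fintype.card {v : Fin n // v ∉ S})

/-- Average precision of a nomination list; the numerator of the `i`-th term is the number of
vertices of the block of interest among the first `i` vertices of the list. -/
def averagePrecision [NeZero K] (b : Fin n → Fin K) (S : Finset (Fin n))
    (L : NominationList S) : ℝ :=
  let u₁ : ℕ := (Sᶜ.filter fun v => b v = 0).card
  (1 / (u₁ : ℝ)) * ∑ i ∈ Finset.Icc 1 u₁,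
    ((Finset.univ.filter fun v : {v : Fin n // v ∉ S} => (L v : ℕ) < i ∧ b v = 0).card : ℝ) / i

open Classical in
/-- Mean average precision of a list chosen uniformly at random among those with property `P`. -/
def meanAP [NeZero K] (b : Fin n → Fin K) (S : Finset (Fin n))
    (P : NominationList S → Prop) : ℝ :=
  (∑ L ∈ (Finset.univ : Finset (NominationList S)).filter P, averagePrecision b S L) /
    (((Finset.univ : Finset (NominationList S)).filter P).card : ℝ)

/-- The feasible block assignments with block sizes `N`, agreeing with `b` on the seeds. -/
def Feasible (N : Fin K → ℕ) (b : Fin n → Fin K) (S : Finset (Fin n))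
    (φ : Fin n → Fin K) : Prop :=
  (∀ k, blockSize φ k = N k) ∧ ∀ i ∈ S, φ i = b i

/-! ### The canonical scheme -/

open Classical in
/-- The conditional probability, given the graph and the blocks of the seeds, that `v` is in the
block of interest, when all feasible block assignments (with the true block sizes) are a priori
equally likely. -/
def posterior [NeZero K] (Λ : Matrix (Fin K) (Fin K) ℝ) (b : Fin n → Fin K)
    (G : SimpleGraph (Fin n)) (S : Finset (Fin n)) (v : Fin n) : ℝ :=
  (∑ φ ∈ Finset.univ.filter fun φ : Fin n → Fin K => Feasible (blockSize b) b S φ ∧ φ v = 0,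
      sbmProb Λ φ G) /
    ∑ φ ∈ Finset.univ.filter fun φ : Fin n → Fin K => Feasible (blockSize b) b S φ,
      sbmProb Λ φ G

/-- The lists that the canonical scheme can produce: nonseeds in the order of decreasing
conditional probability of being in the block of interest (ties in any order). -/
def IsCanonicalList [NeZero K] (Λ : Matrix (Fin K) (Fin K) ℝ) (b : Fin n → Fin K)
    (G : SimpleGraph (Fin n)) (S : Finset (Fin n)) (L : NominationList S) : Prop :=
  ∀ v w : {v : Fin n // v ∉ S}, posterior Λ b G S w < posterior Λ b G S v → L v < L w

/-- `𝔼 AP` of the canonical scheme, with ties broken uniformly at random. -/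
def canonicalEAP [NeZero K] (Λ : Matrix (Fin K) (Fin K) ℝ) (b : Fin n → Fin K) (m : ℕ) : ℝ :=
  expectation Λ b m fun G S => meanAP b S (IsCanonicalList Λ b G S)

/-! ### Estimation of the model parameters from the seeds -/

open Classical in
/-- The estimate of `Λ`: the edge densities between and within the seed blocks. -/
def lambdaHat (b : Fin n → Fin K) (G : SimpleGraph (Fin n)) (S : Finset (Fin n)) :
    Matrix (Fin K) (Fin K) ℝ :=
  fun k l =>
    ((G.edgeFinset.filter fun e =>
      ∃ i ∈ S, ∃ j ∈ S, b i = k ∧ b j = l ∧ e = s(i, j)).card : ℝ) /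
    (if k = l then ((seedCount b S k).choose 2 : ℝ)
      else (seedCount b S k : ℝ) * (seedCount b S l : ℝ))

/-- All log-odds of the estimated probabilities are well defined and finite. -/
def Nondegenerate (M : Matrix (Fin K) (Fin K) ℝ) : Prop := ∀ k l, 0 < M k l ∧ M k l < 1

/-- `N` is a rounding of the estimated block sizes `m_k n / m` to integers with sum `n`. -/
def IsEstimatedSizes (b : Fin n → Fin K) (S : Finset (Fin n)) (N : Fin K → ℕ) : Prop :=
  ∑ k, N k = n ∧ ∀ k, |(N k : ℝ) - (seedCount b S k : ℝ) * n / (S.card : ℝ)| < 1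

/-! ### The restricted-focus maximum likelihood scheme

It only uses the edges between seeds and nonseeds. The matrix `M` is the (estimated) block
probability matrix with which the scheme is run. -/

open Classical in
/-- The objective of the linear assignment problem: the sum over all (seed, nonseed) pairs of
`A i j` times the log-odds. -/
def restrictedObjective (M : Matrix (Fin K) (Fin K) ℝ) (b : Fin n → Fin K)
    (G : SimpleGraph (Fin n)) (S : Finset (Fin n)) (φ : Fin n → Fin K) : ℝ :=
  ∑ i ∈ S, ∑ j ∈ Sᶜ,
    (if G.Adj i j then (1 : ℝ) else 0) * Real.log (M (b i) (φ j) / (1 - M (b i) (φ j)))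

/-- `φ` solves the linear assignment problem with block sizes `N`. -/
def IsRestrictedMLE (M : Matrix (Fin K) (Fin K) ℝ) (N : Fin K → ℕ) (b : Fin n → Fin K)
    (G : SimpleGraph (Fin n)) (S : Finset (Fin n)) (φ : Fin n → Fin K) : Prop :=
  Feasible N b S φ ∧
    ∀ ψ, Feasible N b S ψ → restrictedObjective M b G S ψ ≤ restrictedObjective M b G S φ

open Classical in
/-- The restricted likelihood `ℓ_R`. -/
def restrictedLikelihood (M : Matrix (Fin K) (Fin K) ℝ) (b : Fin n → Fin K)
    (G : SimpleGraph (Fin n)) (S : Finset (Fin n)) (ψ : Fin n → Fin K) : ℝ :=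
  ∏ i ∈ S, ∏ j ∈ Sᶜ, if G.Adj i j then M (b i) (ψ j) else 1 - M (b i) (ψ j)

/-- The likelihood ratio `ℓ_R(φ_{i↔j}) / ℓ_R(φ)`, where `φ_{i↔j}` is `φ` with the blocks of `i`
and `j` exchanged. -/
def swapRatio (M : Matrix (Fin K) (Fin K) ℝ) (b : Fin n → Fin K) (G : SimpleGraph (Fin n))
    (S : Finset (Fin n)) (φ : Fin n → Fin K) (i j : Fin n) : ℝ :=
  restrictedLikelihood M b G S (φ ∘ Equiv.swap i j) / restrictedLikelihood M b G S φ

/-- The geometric mean of the likelihood ratios over the nonseeds `j` not assigned to the block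
of interest. -/
def etaScore [NeZero K] (M : Matrix (Fin K) (Fin K) ℝ) (b : Fin n → Fin K)
    (G : SimpleGraph (Fin n)) (S : Finset (Fin n)) (φ : Fin n → Fin K) (i : Fin n) : ℝ :=
  (∏ j ∈ Sᶜ.filter fun j => φ j ≠ 0, swapRatio M b G S φ i j) ^
    (1 / ((Sᶜ.filter fun j => φ j ≠ 0).card : ℝ))

/-- The geometric mean of the likelihood ratios over the nonseeds `j` assigned to the block of
interest. -/
def xiScore [NeZero K] (M : Matrix (Fin K) (Fin K) ℝ) (b : Fin n → Fin K)
    (G : SimpleGraph (Fin n)) (S : Finset (Fin n)) (φ : Fin n → Fin K) (i : Fin n) : ℝ :=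
  (∏ j ∈ Sᶜ.filter fun j => φ j = 0, swapRatio M b G S φ i j) ^
    (1 / ((Sᶜ.filter fun j => φ j = 0).card : ℝ))

/-- The lists that the restricted-focus scheme can produce from the assignment `φ`: first the
nonseeds assigned to the block of interest, in the order of increasing `η`, then the others, in
the order of decreasing `ξ` (ties in any order). -/
def IsRestrictedList [NeZero K] (M : Matrix (Fin K) (Fin K) ℝ) (b : Fin n → Fin K)
    (G : SimpleGraph (Fin n)) (S : Finset (Fin n)) (φ : Fin n → Fin K)
    (L : NominationList S) : Prop :=
  ∀ v w : {v : Fin n // v ∉ S},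
    (φ v = 0 → φ w ≠ 0 → L v < L w) ∧
    (φ v = 0 → φ w = 0 → etaScore M b G S φ v < etaScore M b G S φ w → L v < L w) ∧
    (φ v ≠ 0 → φ w ≠ 0 → xiScore M b G S φ w < xiScore M b G S φ v → L v < L w)

/-- `φ G S` is, for all graphs and all seed sets of size `m`, a block assignment that the
restricted-focus scheme with parameters estimated from the seeds can select. It may be arbitrary
where the estimated log-odds are not all finite. -/
def IsEstimatedRestrictedSelector (b : Fin n → Fin K) (m : ℕ)
    (φ : SimpleGraph (Fin n) → Finset (Fin n) → Fin n → Fin K) : Prop :=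
  ∀ (G : SimpleGraph (Fin n)) (S : Finset (Fin n)), S.card = m →
    Nondegenerate (lambdaHat b G S) →
    ∃ N, IsEstimatedSizes b S N ∧ IsRestrictedMLE (lambdaHat b G S) N b G S (φ G S)

/-- `𝔼 AP` of the restricted-focus scheme with parameters estimated from the seeds, which uses the
solutions `φ G S` of the linear assignment problem and breaks ties in the list uniformly at
random. -/
def restrictedEAP [NeZero K] (Λ : Matrix (Fin K) (Fin K) ℝ) (b : Fin n → Fin K) (m : ℕ)
    (φ : SimpleGraph (Fin n) → Finset (Fin n) → Fin n → Fin K) : ℝ :=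
  expectation Λ b m fun G S =>
    meanAP b S (IsRestrictedList (lambdaHat b G S) b G S (φ G S))

end VertexNomination

end

/-!
Both schemes have mean average precision tending to `1`, and second moments suffice to show it.
The number `m` of seeds tends to infinity and, if there are at least two blocks, so does the number
`u = n - m` of nonseeds: otherwise the nonseeds would miss the block of interest with a probability bounded from below
(`seedProb_exists_target_le`). With a single block every list has average precision `1`.

*Typical configurations.* By Chebyshev's inequality (`exists_le_expectation`), with high
probability the seed counts deviate from `m * n_k / n` by at most a small multiple of `m * u / n`,
the estimated edge probabilities are close to `Λ`, and all but a small fraction of the nonseeds are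
typical: their frequencies of edges to the seeds of each block are close to the means.

*From classification to ranking.* If a list starts with the nonseeds that satisfy `T`, and `T`
disagrees with membership in the block of interest on `t` nonseeds, then among the first `i ≤ u₁`
vertices at most `t` are wrong, and the average precision is at least `1 - 2 * √(t / u₁)`
(`one_sub_le_averagePrecision`). The order within the two parts of the list is irrelevant.

*The restricted-focus scheme.* On feasible assignments its objective is, up to a constant, a sum over
the nonseeds of log-likelihoods. For a typical vertex the true block beats every other block by a
margin proportional to `m` (`exists_margin`), because `Λ k k ≠ Λ k l`. Comparing the maximizer with
the feasible assignment that is closest to the truth bounds the number of misclassified nonseeds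
by a multiple of the number of atypical ones plus the total error of the estimated block sizes
(`exists_card_misclassified_le`), which is `o(u)`, while `u₁` is of order `u`.

*The canonical scheme.* Given the graph and the blocks of the seeds, average precision is linear in
the indicators of membership in the block of interest, so that the canonical list maximizes its
posterior mean (`sum_candidates_meanAP_le`). As the canonical scheme commutes with permutations of
the vertices, its performance can be averaged over all assignments with the same block sizes, and
it is therefore at least the worst-case performance of any scheme with the same information
(`le_canonicalEAP`). This is applied to the scheme that starts with the vertices whose edge
frequencies look like those of the block of interest.
-/

noncomputable section

namespace VertexNomination

variable {n K : ℕ}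

/-! ### Moments of the edges of the random graph -/

/-- The unordered pairs of distinct vertices, each represented by its increasing ordered pair. -/
def vertexPairs (n : ℕ) : Finset (Fin n × Fin n) :=
  Finset.univ.filter fun p : Fin n × Fin n => p.1 < p.2

open Classical in
/-- Summing over graphs a product over potential edges factorizes over the potential edges. -/
theorem sum_graph_prod (a c : Fin n × Fin n → ℝ) :
    ∑ G : SimpleGraph (Fin n), ∏ p ∈ vertexPairs n, (if G.Adj p.1 p.2 then a p else c p) =
      ∏ p ∈ vertexPairs n, (a p + c p) := by
  rw [Finset.prod_add]
  refine Finset.sum_bij' (fun G _ => (vertexPairs n).filter fun p => G.Adj p.1 p.2)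
    (fun t _ => SimpleGraph.fromRel fun i j => (i, j) ∈ t) ?_ ?_ ?_ ?_ ?_
  · intro G _
    simp
  · intro t _
    simp
  · intro G _
    ext i j
    simp only [SimpleGraph.fromRel_adj, vertexPairs, Finset.mem_filter, Finset.mem_univ, true_and]
    constructor
    · rintro ⟨_, h | h⟩
      · exact h.2
      · exact h.2.symm
    · intro h
      refine ⟨h.ne, ?_⟩
      rcases lt_or_gt_of_ne h.ne with h' | h'
      · exact Or.inl ⟨h', h⟩
      · exact Or.inr ⟨h', h.symm⟩
  · intro t ht
    have ht' : ∀ p ∈ t, p.1 < p.2 := by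
      intro p hp
      have := Finset.mem_powerset.1 ht hp
      simpa [vertexPairs] using this
    ext p
    simp only [SimpleGraph.fromRel_adj, vertexPairs, Finset.mem_filter, Finset.mem_univ, true_and]
    constructor
    · rintro ⟨h, _, h' | h'⟩
      · exact h'
      · exact absurd (ht' _ h') (by simpa using h.le)
    · intro h
      exact ⟨ht' p h, (ht' p h).ne, Or.inl h⟩
  · intro G _
    rw [Finset.prod_ite]
    congr 1
    rw [← Finset.filter_not]

open Classical in
/-- The centred indicator of the potential edge `p`. -/
def edgeDev (Λ : Matrix (Fin K) (Fin K) ℝ) (b : Fin n → Fin K) (G : SimpleGraph (Fin n))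
    (p : Fin n × Fin n) : ℝ :=
  (if G.Adj p.1 p.2 then 1 else 0) - Λ (b p.1) (b p.2)

theorem sbmProb_pos {Λ : Matrix (Fin K) (Fin K) ℝ} (hΛ : ∀ k l, 0 < Λ k l ∧ Λ k l < 1)
    (b : Fin n → Fin K) (G : SimpleGraph (Fin n)) : 0 < sbmProb Λ b G := by
  unfold sbmProb
  refine Finset.prod_pos fun p _ => ?_
  have := hΛ (b p.1) (b p.2)
  split_ifs <;> linarith

theorem sbmProb_nonneg {Λ : Matrix (Fin K) (Fin K) ℝ} (hΛ : ∀ k l, 0 < Λ k l ∧ Λ k l < 1)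
    (b : Fin n → Fin K) (G : SimpleGraph (Fin n)) : 0 ≤ sbmProb Λ b G :=
  (sbmProb_pos hΛ b G).le

theorem sum_sbmProb (Λ : Matrix (Fin K) (Fin K) ℝ) (b : Fin n → Fin K) :
    ∑ G : SimpleGraph (Fin n), sbmProb Λ b G = 1 := by
  have := sum_graph_prod (n := n) (fun p => Λ (b p.1) (b p.2)) (fun p => 1 - Λ (b p.1) (b p.2))
  simpa [sbmProb, vertexPairs] using this

/-- Products of centred indicators of distinct potential edges have mean zero. -/
theorem sum_sbmProb_mul_prod_edgeDev (Λ : Matrix (Fin K) (Fin K) ℝ) (b : Fin n → Fin K)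
    {T : Finset (Fin n × Fin n)} (hT : T ⊆ vertexPairs n) (hne : T.Nonempty) :
    ∑ G : SimpleGraph (Fin n), sbmProb Λ b G * ∏ p ∈ T, edgeDev Λ b G p = 0 := by
  classical
  have key := sum_graph_prod (n := n)
    (fun p => Λ (b p.1) (b p.2) * if p ∈ T then 1 - Λ (b p.1) (b p.2) else 1)
    (fun p => (1 - Λ (b p.1) (b p.2)) * if p ∈ T then 0 - Λ (b p.1) (b p.2) else 1)
  obtain ⟨q, hq⟩ := hne
  rw [Finset.prod_eq_zero (hT hq)] at key
  · rw [← key]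
    refine Finset.sum_congr rfl fun G _ => ?_
    have h1 : ∏ p ∈ T, edgeDev Λ b G p =
        ∏ p ∈ vertexPairs n, if p ∈ T then edgeDev Λ b G p else 1 := by
      rw [Finset.prod_ite_mem, Finset.inter_eq_right.2 hT]
    rw [h1, sbmProb, ← vertexPairs, ← Finset.prod_mul_distrib]
    refine Finset.prod_congr rfl fun p _ => ?_
    unfold edgeDev
    split_ifs <;> simp_all
  · simp only [hq, if_true]
    ring

theorem abs_edgeDev_le_one {Λ : Matrix (Fin K) (Fin K) ℝ} (hΛ : ∀ k l, 0 < Λ k l ∧ Λ k l < 1)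
    (b : Fin n → Fin K) (G : SimpleGraph (Fin n)) (p : Fin n × Fin n) :
    |edgeDev Λ b G p| ≤ 1 := by
  have := hΛ (b p.1) (b p.2)
  unfold edgeDev
  rw [abs_le]
  split_ifs <;> constructor <;> linarith

/-- The number of edges in a set `P` of potential edges has variance at most `|P|`, as the centred
indicators are uncorrelated and bounded by `1`. -/
theorem sum_sbmProb_mul_sq_le {Λ : Matrix (Fin K) (Fin K) ℝ}
    (hΛ : ∀ k l, 0 < Λ k l ∧ Λ k l < 1) (b : Fin n → Fin K)
    {P : Finset (Fin n × Fin n)} (hP : P ⊆ vertexPairs n) :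
    ∑ G : SimpleGraph (Fin n), sbmProb Λ b G * (∑ p ∈ P, edgeDev Λ b G p) ^ 2 ≤ P.card := by
  classical
  have h1 : ∀ G : SimpleGraph (Fin n), sbmProb Λ b G * (∑ p ∈ P, edgeDev Λ b G p) ^ 2 =
      ∑ p ∈ P, ∑ q ∈ P, sbmProb Λ b G * (edgeDev Λ b G p * edgeDev Λ b G q) := by
    intro G
    rw [sq, Finset.sum_mul_sum, Finset.mul_sum]
    simp_rw [Finset.mul_sum]
  simp_rw [h1]
  rw [Finset.sum_comm]
  have h2 : ∀ p ∈ P, ∑ G : SimpleGraph (Fin n), ∑ q ∈ P,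
      sbmProb Λ b G * (edgeDev Λ b G p * edgeDev Λ b G q) ≤ 1 := by
    intro p hp
    rw [Finset.sum_comm, Finset.sum_eq_single p]
    · rw [← sum_sbmProb Λ b]
      refine Finset.sum_le_sum fun G _ => ?_
      have h3 : edgeDev Λ b G p * edgeDev Λ b G p ≤ 1 := by
        have := abs_le.1 (abs_edgeDev_le_one hΛ b G p)
        nlinarith
      have := sbmProb_nonneg hΛ b G
      nlinarith
    · intro q hq hqp
      have := sum_sbmProb_mul_prod_edgeDev Λ b (T := {p, q})
        (by intro r hr; simp at hr; rcases hr with rfl | rfl <;> exact hP ‹_›) (by simp)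
      simpa [Finset.prod_pair hqp.symm] using this
    · exact fun h => absurd hp h
  calc _ ≤ ∑ p ∈ P, (1 : ℝ) := Finset.sum_le_sum h2
    _ = P.card := by simp

/-! ### Moments of the seed counts -/

theorem card_powersetCard_filter_mem_notMem {m : ℕ} (hm : 1 ≤ m) {v w : Fin n} (hvw : v ≠ w) :
    ((Finset.powersetCard m (Finset.univ : Finset (Fin n))).filter
      fun S => v ∈ S ∧ w ∉ S).card = (n - 2).choose (m - 1) := by
  have h1 : ((Finset.univ.erase w).erase v : Finset (Fin n)).card = n - 2 := by
    rw [Finset.card_erase_of_mem (by simp [hvw]), Finset.card_erase_of_mem (by simp)]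
    simp; omega
  rw [← h1, ← Finset.card_powersetCard]
  refine Finset.card_bij' (fun S _ => S.erase v) (fun S _ => insert v S) ?_ ?_ ?_ ?_
  · intro S hS
    simp only [Finset.mem_filter, Finset.mem_powersetCard, Finset.subset_univ, true_and] at hS
    rw [Finset.mem_powersetCard, Finset.card_erase_of_mem hS.2.1, hS.1]
    refine ⟨fun x hx => ?_, rfl⟩
    simp only [Finset.mem_erase, Finset.mem_univ, and_true] at hx ⊢
    exact ⟨hx.1, fun h => hS.2.2 (h ▸ hx.2)⟩
  · intro S hS
    rw [Finset.mem_powersetCard] at hS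
    have hv : v ∉ S := fun h => by simpa using hS.1 h
    have hw : w ∉ S := fun h => by simpa using hS.1 h
    simp [Finset.card_insert_of_notMem hv, hS.2, hw, hvw.symm]
    omega
  · intro S hS
    simp only [Finset.mem_filter] at hS
    exact Finset.insert_erase hS.2.1
  · intro S hS
    rw [Finset.mem_powersetCard] at hS
    have hv : v ∉ S := fun h => by simpa using hS.1 h
    exact Finset.erase_insert hv

/-- The second moment of the sum of a centred function over a uniformly random subset of given
size. As the sums over `S` and over `Sᶜ` are opposite, the square of the former is
`-∑ v ∈ S, ∑ w ∈ Sᶜ, f v * f w`, so only pairs separated by `S` have to be counted. -/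
theorem sum_powersetCard_sq {m : ℕ} (hm : 1 ≤ m) {f : Fin n → ℝ} (hf : ∑ v, f v = 0) :
    ∑ S ∈ Finset.powersetCard m (Finset.univ : Finset (Fin n)), (∑ v ∈ S, f v) ^ 2 =
      ((n - 2).choose (m - 1) : ℝ) * ∑ v, f v ^ 2 := by
  classical
  have h1 : ∀ S : Finset (Fin n), (∑ v ∈ S, f v) ^ 2 =
      ∑ v, ∑ w, if v ∈ S ∧ w ∉ S then -(f v * f w) else 0 := by
    intro S
    have h2 : ∑ v ∈ S, f v = -∑ w ∈ Sᶜ, f w := by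
      have := Finset.sum_add_sum_compl S f
      linarith
    calc (∑ v ∈ S, f v) ^ 2 = (∑ v ∈ S, f v) * (-∑ w ∈ Sᶜ, f w) := by rw [sq, ← h2]
      _ = ∑ v ∈ S, ∑ w ∈ Sᶜ, -(f v * f w) := by
        rw [mul_neg, Finset.sum_mul_sum]
        simp
      _ = _ := by
        rw [← Finset.sum_filter_add_sum_filter_not Finset.univ (fun v => v ∈ S)]
        rw [Finset.sum_eq_zero (s := Finset.univ.filter fun v => v ∉ S), add_zero]
        · refine Finset.sum_congr (by ext; simp) fun v hv => ?_
          rw [← Finset.sum_filter]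
          refine Finset.sum_congr ?_ fun w _ => rfl
          ext w
          simp at hv
          simp [hv]
        · intro v hv
          simp at hv
          simp [hv]
  simp_rw [h1]
  rw [Finset.sum_comm]
  have h3 : ∀ v, ∑ S ∈ Finset.powersetCard m (Finset.univ : Finset (Fin n)),
      ∑ w, (if v ∈ S ∧ w ∉ S then -(f v * f w) else 0) =
      ((n - 2).choose (m - 1) : ℝ) * f v ^ 2 := by
    intro v
    rw [Finset.sum_comm]
    have h4 : ∀ w, ∑ S ∈ Finset.powersetCard m (Finset.univ : Finset (Fin n)),
        (if v ∈ S ∧ w ∉ S then -(f v * f w) else 0) =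
        -((n - 2).choose (m - 1) : ℝ) * f v * f w +
          if w = v then ((n - 2).choose (m - 1) : ℝ) * f v ^ 2 else 0 := by
      intro w
      rw [← Finset.sum_filter, Finset.sum_const]
      by_cases h : w = v
      · subst h
        simp
        ring
      · rw [card_powersetCard_filter_mem_notMem hm (Ne.symm h)]
        simp [h]
        ring
    simp_rw [h4]
    rw [Finset.sum_add_distrib, ← Finset.mul_sum, hf]
    simp
  simp_rw [h3]
  rw [Finset.mul_sum]

theorem choose_sub_two_div_choose {n m : ℕ} (hm : 1 ≤ m) (hmn : m + 1 ≤ n) :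
    ((n - 2).choose (m - 1) : ℝ) / (n.choose m : ℝ) =
      (m : ℝ) * ((n - m : ℕ) : ℝ) / ((n : ℝ) * ((n : ℝ) - 1)) := by
  obtain ⟨r, rfl⟩ : ∃ r, m = r + 1 := ⟨m - 1, by omega⟩
  obtain ⟨s, rfl⟩ : ∃ s, n = s + 2 := ⟨n - 2, by omega⟩
  have h1 := Nat.add_one_mul_choose_eq (s + 1) r
  have h2 := Nat.add_one_mul_choose_eq s r
  have h3 : (s + 1).choose r * (s + 1 - r) = (s + 1) * s.choose r := by
    have := Nat.choose_mul_succ_eq s r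
    linarith
  have hc : ((s + 2).choose (r + 1) : ℝ) ≠ 0 := by
    exact_mod_cast (Nat.choose_pos (by omega)).ne'
  have e : s + 2 - (r + 1) = s + 1 - r := by omega
  rw [e]
  have h1' : ((s : ℝ) + 2) * ((s + 1).choose r : ℝ) = ((s + 2).choose (r + 1) : ℝ) * (r + 1) := by
    have : (((s + 1 + 1) * (s + 1).choose r : ℕ) : ℝ) = _ := congrArg Nat.cast h1
    push_cast at this
    linarith
  have h3' : ((s + 1).choose r : ℝ) * ((s + 1 - r : ℕ) : ℝ) = ((s : ℝ) + 1) * s.choose r := by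
    have : (((s + 1).choose r * (s + 1 - r) : ℕ) : ℝ) = _ := congrArg Nat.cast h3
    push_cast at this
    simpa using this
  simp only [Nat.add_sub_cancel]
  rw [div_eq_div_iff hc (by push_cast; have : (0:ℝ) ≤ s := s.cast_nonneg; nlinarith)]
  push_cast
  linear_combination (-(s:ℝ) - 2) * h3' + ((s + 1 - r : ℕ) : ℝ) * h1'

/-- The variance of the number of seeds in a block. -/
theorem sum_seedCount_sq_le (b : Fin n → Fin K) {m : ℕ} (hm : 1 ≤ m) (hmn : m + 1 ≤ n)
    (k : Fin K) :
    ∑ S ∈ Finset.powersetCard m (Finset.univ : Finset (Fin n)), (1 / (n.choose m : ℝ)) *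
      ((seedCount b S k : ℝ) - m * blockSize b k / n) ^ 2 ≤
      2 * ((m : ℝ) * ((n - m : ℕ) : ℝ) / n) := by
  classical
  have hn : (2 : ℝ) ≤ n := by exact_mod_cast (by omega : 2 ≤ n)
  set f : Fin n → ℝ := fun v => (if b v = k then 1 else 0) - blockSize b k / n with hfdef
  have hb : (blockSize b k : ℝ) ≤ n := by
    have : blockSize b k ≤ n := by
      unfold blockSize
      exact (Finset.card_le_univ _).trans (by simp)
    exact_mod_cast this
  have hf : ∑ v, f v = 0 := by
    simp only [hfdef, Finset.sum_sub_distrib, Finset.sum_const, Finset.card_univ,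
      Fintype.card_fin, nsmul_eq_mul, Finset.sum_boole]
    rw [mul_div_cancel₀ _ (by positivity), blockSize, sub_self]
  have hS : ∀ S ∈ Finset.powersetCard m (Finset.univ : Finset (Fin n)),
      (seedCount b S k : ℝ) - m * blockSize b k / n = ∑ v ∈ S, f v := by
    intro S hS
    rw [Finset.mem_powersetCard] at hS
    simp only [hfdef, Finset.sum_sub_distrib, Finset.sum_const, nsmul_eq_mul, Finset.sum_boole,
      hS.2, seedCount]
    ring
  have hsq : ∑ v, f v ^ 2 ≤ n := by
    calc ∑ v, f v ^ 2 ≤ ∑ v : Fin n, (1 : ℝ) := by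
          refine Finset.sum_le_sum fun v _ => ?_
          have h0 : 0 ≤ (blockSize b k : ℝ) / n := by positivity
          have h1 : (blockSize b k : ℝ) / n ≤ 1 := div_le_one_of_le₀ hb (by positivity)
          simp only [hfdef]
          split_ifs <;> nlinarith
      _ = n := by simp
  rw [← Finset.mul_sum, Finset.sum_congr rfl (fun S h => by rw [hS S h]),
    sum_powersetCard_sq hm hf]
  calc _ = ((n - 2).choose (m - 1) : ℝ) / (n.choose m : ℝ) * ∑ v, f v ^ 2 := by ring
    _ ≤ ((n - 2).choose (m - 1) : ℝ) / (n.choose m : ℝ) * n := by gcongr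
    _ = (m : ℝ) * ((n - m : ℕ) : ℝ) / ((n : ℝ) - 1) := by
      rw [choose_sub_two_div_choose hm hmn]
      field_simp
    _ ≤ (m : ℝ) * ((n - m : ℕ) : ℝ) / ((n : ℝ) / 2) := by
      gcongr
      linarith
    _ = _ := by field_simp

/-! ### Average precision of lists that start with given vertices -/

/-- Every key on the nonseeds with values in a linear order is monotone along some list. -/
theorem exists_nominationList_of_key {α : Type*} [LinearOrder α] {S : Finset (Fin n)}
    (key : {v : Fin n // v ∉ S} → α) :
    ∃ L : NominationList S, ∀ v w, key v < key w → L v < L w := by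
  classical
  let e := Fintype.equivFin {v : Fin n // v ∉ S}
  let f := key ∘ e.symm
  refine ⟨e.trans (Tuple.sort f).symm, fun v w h => ?_⟩
  by_contra hlt
  have h1 := Tuple.monotone_sort f (not_lt.1 hlt)
  simp [f] at h1
  exact absurd h (not_lt.2 h1)

/-- The number of vertices of the block of interest among the first `i` of the list. -/
def prefixHits [NeZero K] (b : Fin n → Fin K) (S : Finset (Fin n)) (L : NominationList S)
    (i : ℕ) : ℕ :=
  (Finset.univ.filter fun v : {v : Fin n // v ∉ S} => (L v : ℕ) < i ∧ b v = 0).card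

/-- The number of nonseeds in the block of interest. -/
def targetCount [NeZero K] (b : Fin n → Fin K) (S : Finset (Fin n)) : ℕ :=
  (Sᶜ.filter fun v => b v = 0).card

theorem averagePrecision_eq [NeZero K] (b : Fin n → Fin K) (S : Finset (Fin n))
    (L : NominationList S) :
    averagePrecision b S L = (1 / (targetCount b S : ℝ)) *
      ∑ i ∈ Finset.Icc 1 (targetCount b S), (prefixHits b S L i : ℝ) / i := rfl

theorem targetCount_eq_card_subtype [NeZero K] (b : Fin n → Fin K) (S : Finset (Fin n)) :
    targetCount b S = (Finset.univ.filter fun v : {v : Fin n // v ∉ S} => b v = 0).card := by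
  classical
  unfold targetCount
  symm
  refine Finset.card_bij (fun v _ => v.1) ?_ ?_ ?_
  · intro v hv
    simpa [v.2] using hv
  · intro v _ w _ h
    exact Subtype.ext h
  · intro v hv
    simp at hv
    exact ⟨⟨v, hv.1⟩, by simp [hv.2], rfl⟩

theorem card_prefix {S : Finset (Fin n)} (L : NominationList S) (i : ℕ) :
    (Finset.univ.filter fun v : {v : Fin n // v ∉ S} => (L v : ℕ) < i).card =
      min i (Fintype.card {v : Fin n // v ∉ S}) := by
  classical
  rw [← Finset.card_map L.toEmbedding]
  have : (Finset.univ.filter fun v : {v : Fin n // v ∉ S} => (L v : ℕ) < i).map L.toEmbedding =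
      Finset.univ.filter fun j : Fin (Fintype.card {v : Fin n // v ∉ S}) => (j : ℕ) < i := by
    ext j
    simp only [Finset.mem_map, Finset.mem_filter, Finset.mem_univ, true_and,
      Equiv.coe_toEmbedding]
    constructor
    · rintro ⟨v, hv, rfl⟩
      exact hv
    · intro h
      exact ⟨L.symm j, by simpa using h, by simp⟩
  rw [this, Fin.card_filter_val_lt]
  exact min_comm _ _

theorem prefixHits_le [NeZero K] (b : Fin n → Fin K) (S : Finset (Fin n)) (L : NominationList S)
    (i : ℕ) : prefixHits b S L i ≤ i := by
  refine le_trans (Finset.card_le_card ?_) ((card_prefix L i).trans_le (min_le_left _ _))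
  intro v
  simp
  tauto

theorem averagePrecision_nonneg [NeZero K] (b : Fin n → Fin K) (S : Finset (Fin n))
    (L : NominationList S) : 0 ≤ averagePrecision b S L := by
  rw [averagePrecision_eq]
  exact mul_nonneg (by positivity) (Finset.sum_nonneg fun _ _ => by positivity)

theorem averagePrecision_le_one [NeZero K] (b : Fin n → Fin K) (S : Finset (Fin n))
    (L : NominationList S) : averagePrecision b S L ≤ 1 := by
  rw [averagePrecision_eq]
  have : ∑ i ∈ Finset.Icc 1 (targetCount b S), (prefixHits b S L i : ℝ) / i ≤
      targetCount b S := by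
    calc _ ≤ ∑ i ∈ Finset.Icc 1 (targetCount b S), (1 : ℝ) := by
          refine Finset.sum_le_sum fun i _ => ?_
          exact div_le_one_of_le₀ (by exact_mod_cast prefixHits_le b S L i) (by positivity)
      _ = _ := by simp
  rw [one_div_mul_eq_div]
  exact div_le_one_of_le₀ this (by positivity)

open Classical in
/-- The number of nonseeds on which the predicate `T` disagrees with membership in the block of
interest. -/
def mismatchCount [NeZero K] (b : Fin n → Fin K) (S : Finset (Fin n)) (T : Fin n → Prop) : ℕ :=
  (Finset.univ.filter fun v : {v : Fin n // v ∉ S} => ¬(T v ↔ b v = 0)).card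

/-- If a list starts with the vertices satisfying `T`, then all but `mismatchCount b S T` of its
first `i ≤ u₁` vertices are in the block of interest: either these `i` vertices all satisfy `T`,
or they comprise all vertices satisfying `T`. -/
theorem le_prefixHits_add_mismatchCount [NeZero K] {b : Fin n → Fin K} {S : Finset (Fin n)}
    {L : NominationList S} {T : Fin n → Prop}
    (hL : ∀ v w : {v : Fin n // v ∉ S}, T v → ¬T w → L v < L w) {i : ℕ}
    (hi : i ≤ targetCount b S) : i ≤ prefixHits b S L i + mismatchCount b S T := by
  classical
  unfold prefixHits mismatchCount
  rw [targetCount_eq_card_subtype] at hi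
  by_cases hall : ∀ v : {v : Fin n // v ∉ S}, (L v : ℕ) < i → T v
  · have h1 : min i (Fintype.card {v : Fin n // v ∉ S}) = i :=
      min_eq_left (hi.trans (Finset.card_le_univ _))
    refine (h1.symm.trans (card_prefix L i).symm).le.trans
      ((Finset.card_le_card ?_).trans (Finset.card_union_le _ _))
    intro v
    have := hall v
    simp only [Finset.mem_filter, Finset.mem_union, Finset.mem_univ, true_and]
    tauto
  · push Not at hall
    obtain ⟨w, hw, hTw⟩ := hall
    refine hi.trans ((Finset.card_le_card ?_).trans (Finset.card_union_le _ _))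
    intro v
    simp only [Finset.mem_filter, Finset.mem_union, Finset.mem_univ, true_and]
    intro hv
    by_cases hT : T v
    · left
      have h2 : (L v : ℕ) < L w := hL v w hT hTw
      exact ⟨h2.trans hw, hv⟩
    · right
      tauto

theorem sum_one_div_sqrt_le (u : ℕ) :
    ∑ i ∈ Finset.Icc 1 u, 1 / √(i : ℝ) ≤ 2 * √(u : ℝ) := by
  induction u with
  | zero => simp
  | succ u ih =>
    rw [Finset.sum_Icc_succ_top (by omega)]
    have hpos : 0 < √((u + 1 : ℕ) : ℝ) := Real.sqrt_pos.2 (by positivity)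
    have h0 : 0 ≤ √(u : ℝ) := Real.sqrt_nonneg _
    have h1 : √((u + 1 : ℕ) : ℝ) ^ 2 = u + 1 := by
      rw [Real.sq_sqrt (by positivity)]
      push_cast
      ring
    have h2 : √(u : ℝ) ^ 2 = u := Real.sq_sqrt (by positivity)
    have h3 : 1 / √((u + 1 : ℕ) : ℝ) ≤ 2 * √((u + 1 : ℕ) : ℝ) - 2 * √(u : ℝ) := by
      rw [div_le_iff₀ hpos]
      nlinarith [sq_nonneg (√((u + 1 : ℕ) : ℝ) - √(u : ℝ))]
    linarith

/-- A list that starts with the vertices satisfying `T` has average precision close to `1` if `T`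
has few mismatches compared with the size of the block of interest among the nonseeds. -/
theorem one_sub_le_averagePrecision [NeZero K] {b : Fin n → Fin K} {S : Finset (Fin n)}
    {L : NominationList S} {T : Fin n → Prop}
    (hL : ∀ v w : {v : Fin n // v ∉ S}, T v → ¬T w → L v < L w) (hu : 0 < targetCount b S) :
    1 - 2 * √((mismatchCount b S T : ℝ) / targetCount b S) ≤ averagePrecision b S L := by
  set u := targetCount b S with hudef
  set t := mismatchCount b S T with ht
  have hu' : (0 : ℝ) < u := by exact_mod_cast hu
  -- The `i`-th precision is at least `1 - min 1 (t / i)`, and `min 1 x ≤ √x`.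
  have h1 : ∀ i ∈ Finset.Icc 1 u,
      1 - √(t : ℝ) * (1 / √(i : ℝ)) ≤ (prefixHits b S L i : ℝ) / i := by
    intro i hi
    rw [Finset.mem_Icc] at hi
    have hipos : (0 : ℝ) < i := by exact_mod_cast hi.1
    have h2 : (i : ℝ) ≤ prefixHits b S L i + t := by
      exact_mod_cast le_prefixHits_add_mismatchCount hL hi.2
    have h3 : √(t : ℝ) * (1 / √(i : ℝ)) = √((t : ℝ) / i) := by
      rw [Real.sqrt_div (by positivity)]
      ring
    rw [h3]
    have h0 : (0 : ℝ) ≤ (t : ℝ) / i := by positivity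
    rcases le_total ((t : ℝ) / i) 1 with h4 | h4
    · have h5 : (t : ℝ) / i ≤ √((t : ℝ) / i) := by
        apply Real.le_sqrt_of_sq_le
        nlinarith
      have h6 : 1 - (t : ℝ) / i ≤ (prefixHits b S L i : ℝ) / i := by
        rw [sub_le_iff_le_add, ← add_div, le_div_iff₀ hipos]
        linarith
      linarith
    · have h5 : 1 ≤ √((t : ℝ) / i) := Real.one_le_sqrt.2 h4
      have : (0 : ℝ) ≤ (prefixHits b S L i : ℝ) / i := by positivity
      linarith
  rw [averagePrecision_eq, ← hudef, one_div_mul_eq_div, le_div_iff₀ hu']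
  refine le_trans ?_ (Finset.sum_le_sum h1)
  rw [Finset.sum_sub_distrib, ← Finset.mul_sum]
  have h7 : √(t : ℝ) * ∑ i ∈ Finset.Icc 1 u, 1 / √(i : ℝ) ≤ √(t : ℝ) * (2 * √(u : ℝ)) := by
    gcongr
    exact sum_one_div_sqrt_le u
  have h8 : √((t : ℝ) / u) * u = √(t : ℝ) * √(u : ℝ) := by
    rw [Real.sqrt_div (by positivity)]
    have : √(u : ℝ) * √(u : ℝ) = u := Real.mul_self_sqrt hu'.le
    have h9 : √(u : ℝ) ≠ 0 := (Real.sqrt_pos.2 hu').ne'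
    rw [div_mul_eq_mul_div, div_eq_iff h9, mul_assoc, this]
  simp only [Finset.sum_const, Nat.card_Icc, nsmul_eq_mul, add_tsub_cancel_right, mul_one]
  nlinarith

theorem meanAP_nonneg [NeZero K] (b : Fin n → Fin K) (S : Finset (Fin n))
    (P : NominationList S → Prop) : 0 ≤ meanAP b S P :=
  div_nonneg (Finset.sum_nonneg fun L _ => averagePrecision_nonneg b S L) (by positivity)

theorem meanAP_le_one [NeZero K] (b : Fin n → Fin K) (S : Finset (Fin n))
    (P : NominationList S → Prop) : meanAP b S P ≤ 1 := by
  refine div_le_one_of_le₀ ?_ (by positivity)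
  calc _ ≤ ∑ L ∈ _, (1 : ℝ) := Finset.sum_le_sum fun L _ => averagePrecision_le_one b S L
    _ = _ := by simp

theorem le_meanAP [NeZero K] {b : Fin n → Fin K} {S : Finset (Fin n)}
    {P : NominationList S → Prop} (hP : ∃ L, P L) {a : ℝ}
    (ha : ∀ L, P L → a ≤ averagePrecision b S L) : a ≤ meanAP b S P := by
  classical
  obtain ⟨L, hL⟩ := hP
  unfold meanAP
  rw [le_div_iff₀ (by
    have : 0 < ((Finset.univ : Finset (NominationList S)).filter P).card :=
      Finset.card_pos.2 ⟨L, by simpa using hL⟩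
    exact_mod_cast this), mul_comm, ← nsmul_eq_mul]
  refine Finset.card_nsmul_le_sum _ _ _ fun L hL => ha L ?_
  simpa using hL

/-- The lists that start with the nonseeds satisfying `T`. -/
def StartsWith (S : Finset (Fin n)) (T : Fin n → Prop) (L : NominationList S) : Prop :=
  ∀ v w : {v : Fin n // v ∉ S}, T v → ¬T w → L v < L w

theorem exists_startsWith (S : Finset (Fin n)) (T : Fin n → Prop) : ∃ L, StartsWith S T L := by
  classical
  obtain ⟨L, hL⟩ := exists_nominationList_of_key
    fun v : {v : Fin n // v ∉ S} => if T v then (0 : ℕ) else 1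
  exact ⟨L, fun v w hv hw => hL v w (by simp [hv, hw])⟩

theorem exists_isRestrictedList [NeZero K] (M : Matrix (Fin K) (Fin K) ℝ) (b : Fin n → Fin K)
    (G : SimpleGraph (Fin n)) (S : Finset (Fin n)) (φ : Fin n → Fin K) :
    ∃ L, IsRestrictedList M b G S φ L := by
  classical
  obtain ⟨L, hL⟩ := exists_nominationList_of_key fun v : {v : Fin n // v ∉ S} =>
    toLex ((if φ v = 0 then (0 : ℕ) else 1),
      if φ v = 0 then etaScore M b G S φ v else -xiScore M b G S φ v)
  refine ⟨L, fun v w => ⟨fun hv hw => hL v w ?_, fun hv hw h => hL v w ?_,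
    fun hv hw h => hL v w ?_⟩⟩ <;> rw [Prod.Lex.toLex_lt_toLex]
  · simp [hv, hw]
  · simp [hv, hw, h]
  · simp [hv, hw, h]

theorem exists_isCanonicalList [NeZero K] (Λ : Matrix (Fin K) (Fin K) ℝ) (b : Fin n → Fin K)
    (G : SimpleGraph (Fin n)) (S : Finset (Fin n)) : ∃ L, IsCanonicalList Λ b G S L := by
  obtain ⟨L, hL⟩ := exists_nominationList_of_key fun v : {v : Fin n // v ∉ S} =>
    -posterior Λ b G S v
  exact ⟨L, fun v w h => hL v w (by simpa using h)⟩

/-! ### Log-likelihood margins -/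

/-- The log-likelihood per trial of a Bernoulli parameter `q` when a fraction `x` of the trials
succeeds. -/
def bernoulliLogLik (x q : ℝ) : ℝ := x * Real.log q + (1 - x) * Real.log (1 - q)

/-- Gibbs' inequality: the likelihood has its strict maximum at the observed frequency. -/
theorem bernoulliLogLik_lt_self {x q : ℝ} (hx : 0 < x ∧ x < 1) (hq : 0 < q ∧ q < 1)
    (hne : x ≠ q) : bernoulliLogLik x q < bernoulliLogLik x x := by
  unfold bernoulliLogLik
  have hx1 : 0 < 1 - x := by linarith
  have h1 : Real.log q - Real.log x < q / x - 1 := by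
    rw [← Real.log_div hq.1.ne' hx.1.ne']
    refine Real.log_lt_sub_one_of_pos (div_pos hq.1 hx.1) ?_
    rw [Ne, div_eq_one_iff_eq hx.1.ne']
    exact hne.symm
  have h2 : Real.log (1 - q) - Real.log (1 - x) ≤ (1 - q) / (1 - x) - 1 := by
    rw [← Real.log_div (by linarith) hx1.ne']
    exact Real.log_le_sub_one_of_pos (div_pos (by linarith) hx1)
  have h3 : x * (Real.log q - Real.log x) < q - x := by
    calc _ < x * (q / x - 1) := by gcongr; exact hx.1
      _ = q - x := by rw [mul_sub, mul_div_cancel₀ _ hx.1.ne', mul_one]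
  have h4 : (1 - x) * (Real.log (1 - q) - Real.log (1 - x)) ≤ x - q := by
    calc _ ≤ (1 - x) * ((1 - q) / (1 - x) - 1) := by gcongr
      _ = x - q := by field_simp; ring
  linarith

theorem bernoulliLogLik_le_self {x q : ℝ} (hx : 0 < x ∧ x < 1) (hq : 0 < q ∧ q < 1) :
    bernoulliLogLik x q ≤ bernoulliLogLik x x := by
  rcases eq_or_ne x q with h | h
  · rw [h]
  · exact (bernoulliLogLik_lt_self hx hq h).le

theorem eventually_bernoulliLogLik_sub {a q q' δ : ℝ} (hq : 0 < q ∧ q < 1)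
    (hq' : 0 < q' ∧ q' < 1) (hδ : 0 < δ) :
    ∀ᶠ ε in 𝓝[>] (0 : ℝ), ∀ x r r' : ℝ, |x - a| ≤ ε → |r - q| ≤ ε → |r' - q'| ≤ ε →
      bernoulliLogLik a q - bernoulliLogLik a q' - δ <
        bernoulliLogLik x r - bernoulliLogLik x r' := by
  have hcont : ContinuousAt (fun p : ℝ × ℝ × ℝ =>
      bernoulliLogLik p.1 p.2.1 - bernoulliLogLik p.1 p.2.2) (a, q, q') := by
    unfold bernoulliLogLik
    have h1 : q ≠ 0 := hq.1.ne'
    have h2 : 1 - q ≠ 0 := by linarith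
    have h3 : q' ≠ 0 := hq'.1.ne'
    have h4 : 1 - q' ≠ 0 := by linarith
    fun_prop (disch := assumption)
  have hev := hcont.eventually (lt_mem_nhds (sub_lt_self
    (bernoulliLogLik a q - bernoulliLogLik a q') hδ))
  obtain ⟨r, hr, hball⟩ := Metric.mem_nhds_iff.1 hev
  filter_upwards [Ioo_mem_nhdsGT hr] with ε hε x y y' hx hy hy'
  have : ((x, y, y') : ℝ × ℝ × ℝ) ∈ Metric.ball ((a, q, q') : ℝ × ℝ × ℝ) r := by
    rw [Metric.mem_ball, Prod.dist_eq, Prod.dist_eq, max_lt_iff, max_lt_iff]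
    simp only [Real.dist_eq]
    exact ⟨hx.trans_lt hε.2, hy.trans_lt hε.2, hy'.trans_lt hε.2⟩
  exact hball this

/-- Constants for the likelihood comparison of blocks, uniformly over matrices `M` close to `Λ`:
as soon as the observed frequencies `x k` are close to those of a vertex of block `a`, block `a`
beats every other block `l` by a margin `κ` per seed, provided every block has at least the
fraction `c` of the total weight; on any observation two blocks differ by at most `B` per seed.
The margin is due to the seeds of block `a` itself, because `Λ a a ≠ Λ a l`. -/
theorem exists_margin {Λ : Matrix (Fin K) (Fin K) ℝ} (hΛ : ∀ k l, 0 < Λ k l ∧ Λ k l < 1)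
    (hdist : ∀ k l, k ≠ l → Λ k k ≠ Λ k l) {c : ℝ} (hc : 0 < c) :
    ∃ ε > 0, ∃ κ > 0, ∃ B ≥ 0, ∀ M : Matrix (Fin K) (Fin K) ℝ,
      (∀ k l, |M k l - Λ k l| ≤ ε) → Nondegenerate M ∧
      (∀ x k l l', 0 ≤ x → x ≤ 1 →
        -B ≤ bernoulliLogLik x (M k l) - bernoulliLogLik x (M k l')) ∧
      ∀ a l, a ≠ l → ∀ x w : Fin K → ℝ, (∀ k, c * ∑ j, w j ≤ w k) → (∀ k, 0 ≤ w k) →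
        (∀ k, |x k - Λ k a| ≤ ε) → κ * ∑ j, w j ≤
          ∑ k, w k * (bernoulliLogLik (x k) (M k a) - bernoulliLogLik (x k) (M k l)) := by
  -- `κ` bounds the divergences between `Λ a a` and `Λ a l` from below; the final margin is
  -- `c * κ / 2`, as the seeds of block `a` have weight at least `c` and the error of every term is
  -- at most `c * κ / 2`.
  have hκ : ∀ᶠ κ in 𝓝[>] (0 : ℝ), ∀ a l, a ≠ l →
      κ < bernoulliLogLik (Λ a a) (Λ a a) - bernoulliLogLik (Λ a a) (Λ a l) := by
    rw [eventually_all]; intro a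
    rw [eventually_all]; intro l
    by_cases h : a = l
    · simp [h]
    · have := bernoulliLogLik_lt_self (hΛ a a) (hΛ a l) (hdist a l h)
      filter_upwards [Ioo_mem_nhdsGT (sub_pos.2 this)] with κ hκ _
      exact hκ.2
  obtain ⟨κ, hκ, hκpos⟩ := (hκ.and self_mem_nhdsWithin).exists
  replace hκpos : 0 < κ := hκpos
  -- The entries of `M` stay in `[p, 1 - p]`.
  have hp : ∀ᶠ p in 𝓝[>] (0 : ℝ), ∀ k l, p < Λ k l / 2 ∧ p < (1 - Λ k l) / 2 := by
    rw [eventually_all]; intro a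
    rw [eventually_all]; intro l
    have := hΛ a l
    filter_upwards [Ioo_mem_nhdsGT (show 0 < Λ a l / 2 by linarith),
      Ioo_mem_nhdsGT (show 0 < (1 - Λ a l) / 2 by linarith)] with p h1 h2
    exact ⟨h1.2, h2.2⟩
  obtain ⟨p, hp, hppos⟩ := (hp.and self_mem_nhdsWithin).exists
  replace hppos : 0 < p := hppos
  have hδ : 0 < c * κ / 2 := by positivity
  have hε : ∀ᶠ ε in 𝓝[>] (0 : ℝ), ∀ k a l, ∀ x r r' : ℝ,
      |x - Λ k a| ≤ ε → |r - Λ k a| ≤ ε → |r' - Λ k l| ≤ ε →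
      bernoulliLogLik (Λ k a) (Λ k a) - bernoulliLogLik (Λ k a) (Λ k l) - c * κ / 2 <
        bernoulliLogLik x r - bernoulliLogLik x r' := by
    rw [eventually_all]; intro k
    rw [eventually_all]; intro a
    rw [eventually_all]; intro l
    exact eventually_bernoulliLogLik_sub (hΛ k a) (hΛ k l) hδ
  obtain ⟨ε, hε, hεp⟩ := (hε.and (Ioo_mem_nhdsGT hppos)).exists
  refine ⟨ε, hεp.1, c * κ / 2, hδ, |Real.log p|, abs_nonneg _, fun M hM => ?_⟩
  have hMp : ∀ k l, p ≤ M k l ∧ p ≤ 1 - M k l := by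
    intro k l
    have h1 := abs_le.1 (hM k l)
    have h2 := hp k l
    have h3 := hεp.2
    constructor <;> linarith
  refine ⟨fun k l => ?_, ?_, ?_⟩
  · have := hMp k l
    constructor <;> linarith
  · intro x k l l' hx0 hx1
    have hx1' : 0 ≤ 1 - x := by linarith
    have hlogp : ∀ y, p ≤ y → y ≤ 1 → Real.log p ≤ Real.log y ∧ Real.log y ≤ 0 := fun y h1 h2 =>
      ⟨Real.log_le_log hppos h1, Real.log_nonpos (hppos.le.trans h1) h2⟩
    have h1 := hMp k l
    have h2 := hMp k l'
    have a1 := hlogp (M k l) h1.1 (by linarith)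
    have a2 := hlogp (1 - M k l) h1.2 (by linarith)
    have a3 := hlogp (M k l') h2.1 (by linarith)
    have a4 := hlogp (1 - M k l') h2.2 (by linarith)
    rw [abs_of_nonpos (a1.1.trans a1.2)]
    unfold bernoulliLogLik
    have b1 := mul_le_mul_of_nonneg_left a1.1 hx0
    have b2 := mul_le_mul_of_nonneg_left a2.1 hx1'
    have b3 := mul_nonpos_of_nonneg_of_nonpos hx0 a3.2
    have b4 := mul_nonpos_of_nonneg_of_nonpos hx1' a4.2
    linarith
  · intro a l hal x w hwc hw0 hx
    have hterm : ∀ k, w k * (-(c * κ / 2)) + (if k = a then w a * κ else 0) ≤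
        w k * (bernoulliLogLik (x k) (M k a) - bernoulliLogLik (x k) (M k l)) := by
      intro k
      have h1 := hε k a l (x k) (M k a) (M k l) (hx k) (hM k a) (hM k l)
      split_ifs with hk
      · subst hk
        rw [← mul_add]
        refine mul_le_mul_of_nonneg_left ?_ (hw0 k)
        have := hκ k l hal
        linarith
      · rw [add_zero]
        refine mul_le_mul_of_nonneg_left ?_ (hw0 k)
        have := bernoulliLogLik_le_self (hΛ k a) (hΛ k l)
        linarith
    refine le_trans ?_ (Finset.sum_le_sum fun k _ => hterm k)
    rw [Finset.sum_add_distrib, ← Finset.sum_mul]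
    simp only [Finset.sum_ite_eq', Finset.mem_univ, if_true]
    have := mul_le_mul_of_nonneg_right (hwc a) hκpos.le
    linarith

/-! ### The restricted maximum likelihood assignment -/

open Classical in
/-- The number of seeds of block `k` adjacent to `v`. -/
def seedDegree (b : Fin n → Fin K) (G : SimpleGraph (Fin n)) (S : Finset (Fin n)) (v : Fin n)
    (k : Fin K) : ℕ :=
  (S.filter fun i => b i = k ∧ G.Adj i v).card

theorem seedDegree_le (b : Fin n → Fin K) (G : SimpleGraph (Fin n)) (S : Finset (Fin n))
    (v : Fin n) (k : Fin K) : seedDegree b G S v k ≤ seedCount b S k := by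
  classical
  refine Finset.card_le_card fun i => ?_
  simp
  tauto

theorem sum_seedCount (b : Fin n → Fin K) (S : Finset (Fin n)) :
    ∑ k, seedCount b S k = S.card :=
  (Finset.card_eq_sum_card_fiberwise (f := b) (t := Finset.univ) fun _ _ => by simp).symm

theorem sum_blockSize (b : Fin n → Fin K) : ∑ k, blockSize b k = n := by
  have := (Finset.card_eq_sum_card_fiberwise (s := Finset.univ) (f := b) (t := Finset.univ)
    fun _ _ => by simp).symm
  simpa [blockSize] using this

/-- The log-likelihood of the edges between `v` and the seeds when `v` is assigned to block `l`. -/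
def seedLogLik (M : Matrix (Fin K) (Fin K) ℝ) (b : Fin n → Fin K) (G : SimpleGraph (Fin n))
    (S : Finset (Fin n)) (v : Fin n) (l : Fin K) : ℝ :=
  ∑ k, ((seedDegree b G S v k : ℝ) * Real.log (M k l) +
    ((seedCount b S k : ℝ) - seedDegree b G S v k) * Real.log (1 - M k l))

theorem seedLogLik_sub {M : Matrix (Fin K) (Fin K) ℝ} {b : Fin n → Fin K}
    {G : SimpleGraph (Fin n)} {S : Finset (Fin n)} (hS : ∀ k, 0 < seedCount b S k)
    (v : Fin n) (l l' : Fin K) :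
    seedLogLik M b G S v l - seedLogLik M b G S v l' = ∑ k, (seedCount b S k : ℝ) *
      (bernoulliLogLik ((seedDegree b G S v k : ℝ) / seedCount b S k) (M k l) -
        bernoulliLogLik ((seedDegree b G S v k : ℝ) / seedCount b S k) (M k l')) := by
  unfold seedLogLik bernoulliLogLik
  rw [← Finset.sum_sub_distrib]
  refine Finset.sum_congr rfl fun k _ => ?_
  have : (seedCount b S k : ℝ) ≠ 0 := by exact_mod_cast (hS k).ne'
  field_simp

theorem sum_compl_comp_eq {N : Fin K → ℕ} {b φ : Fin n → Fin K} {S : Finset (Fin n)}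
    (hφ : Feasible N b S φ) (h : Fin K → ℝ) :
    ∑ v ∈ Sᶜ, h (φ v) = ∑ l, (N l : ℝ) * h l - ∑ v ∈ S, h (b v) := by
  classical
  have h1 : ∑ v, h (φ v) = ∑ l, (N l : ℝ) * h l := by
    rw [← Finset.sum_fiberwise Finset.univ φ]
    refine Finset.sum_congr rfl fun l _ => ?_
    rw [← hφ.1 l, blockSize, Finset.sum_congr rfl (g := fun _ => h l), Finset.sum_const,
      nsmul_eq_mul]
    intro v hv
    rw [(Finset.mem_filter.1 hv).2]
  have h2 := Finset.sum_add_sum_compl S fun v => h (φ v)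
  have h3 : ∑ v ∈ S, h (φ v) = ∑ v ∈ S, h (b v) :=
    Finset.sum_congr rfl fun v hv => by rw [hφ.2 v hv]
  linarith

/-- The objective of the assignment problem differs from the log-likelihood only by a term that
depends on the block sizes. -/
theorem restrictedObjective_eq {M : Matrix (Fin K) (Fin K) ℝ} (hM : Nondegenerate M)
    (b : Fin n → Fin K) (G : SimpleGraph (Fin n)) (S : Finset (Fin n)) (φ : Fin n → Fin K) :
    restrictedObjective M b G S φ = ∑ v ∈ Sᶜ, seedLogLik M b G S v (φ v) -
      ∑ v ∈ Sᶜ, ∑ k, (seedCount b S k : ℝ) * Real.log (1 - M k (φ v)) := by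
  classical
  unfold restrictedObjective
  rw [Finset.sum_comm, ← Finset.sum_sub_distrib]
  refine Finset.sum_congr rfl fun v _ => ?_
  unfold seedLogLik
  rw [← Finset.sum_sub_distrib, ← Finset.sum_fiberwise S b]
  refine Finset.sum_congr rfl fun k _ => ?_
  have h0 : 1 - M k (φ v) ≠ 0 := by linarith [(hM k (φ v)).2]
  have h1 : ∀ i ∈ S.filter fun i => b i = k,
      (if G.Adj i v then (1 : ℝ) else 0) * Real.log (M (b i) (φ v) / (1 - M (b i) (φ v))) =
      (if G.Adj i v then (1 : ℝ) else 0) * Real.log (M k (φ v) / (1 - M k (φ v))) := by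
    intro i hi
    rw [(Finset.mem_filter.1 hi).2]
  rw [Finset.sum_congr rfl h1, ← Finset.sum_mul, Finset.sum_boole, Finset.filter_filter,
    Real.log_div (hM k (φ v)).1.ne' h0]
  simp only [seedDegree]
  ring

/-- Among feasible assignments, a solution of the assignment problem maximizes the
log-likelihood. -/
theorem IsRestrictedMLE.sum_seedLogLik_le {M : Matrix (Fin K) (Fin K) ℝ} (hM : Nondegenerate M)
    {N : Fin K → ℕ} {b : Fin n → Fin K} {G : SimpleGraph (Fin n)} {S : Finset (Fin n)}
    {φ ψ : Fin n → Fin K} (hφ : IsRestrictedMLE M N b G S φ) (hψ : Feasible N b S ψ) :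
    ∑ v ∈ Sᶜ, seedLogLik M b G S v (ψ v) ≤ ∑ v ∈ Sᶜ, seedLogLik M b G S v (φ v) := by
  have h := hφ.2 ψ hψ
  rw [restrictedObjective_eq hM, restrictedObjective_eq hM,
    sum_compl_comp_eq hψ (fun l => ∑ k, (seedCount b S k : ℝ) * Real.log (1 - M k l)),
    sum_compl_comp_eq hφ.1 (fun l => ∑ k, (seedCount b S k : ℝ) * Real.log (1 - M k l))] at h
  linarith

theorem blockSize_update (b : Fin n → Fin K) (v : Fin n) (k j : Fin K) : (blockSize (Function.update b v k) j : ℤ) =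
      blockSize b j + (if j = k then 1 else 0) - (if j = b v then 1 else 0) := by
  classical
  have h : ∀ f : Fin n → Fin K, (blockSize f j : ℤ) = ∑ w, if f w = j then (1 : ℤ) else 0 := by
    intro f
    simp [blockSize]
  rw [h, h, ← Finset.add_sum_erase _ _ (Finset.mem_univ v),
    ← Finset.add_sum_erase (a := v) Finset.univ (fun w => if b w = j then (1 : ℤ) else 0)
      (Finset.mem_univ v)]
  rw [Finset.sum_congr rfl (g := fun w => if b w = j then (1 : ℤ) else 0) (fun w hw => by
    rw [Function.update_of_ne (Finset.ne_of_mem_erase hw)])]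
  rw [Function.update_self]
  simp only [eq_comm (a := j)]
  ring

/-- The block sizes of an assignment can be corrected, without touching the seeds, by changing
only as many labels as there are vertices missing in the blocks that are too small. -/
theorem exists_feasible_near {N : Fin K → ℕ} (hN : ∑ k, N k = n) {S : Finset (Fin n)}
    (d : ℕ) : ∀ b : Fin n → Fin K, (∀ k, seedCount b S k ≤ N k) →
    ∑ k, (N k - blockSize b k) = d →
    ∃ ψ, Feasible N b S ψ ∧ (Sᶜ.filter fun v => ψ v ≠ b v).card ≤ d := by
  classical
  induction d with
  | zero =>
    intro b hS hd
    refine ⟨b, ⟨fun k => ?_, fun _ _ => rfl⟩, by simp⟩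
    have hle : ∀ k ∈ Finset.univ, N k ≤ blockSize b k := by
      intro k hk
      have := (Finset.sum_eq_zero_iff.1 hd) k hk
      omega
    have := (Finset.sum_eq_sum_iff_of_le hle).1 (hN.trans (sum_blockSize b).symm)
    exact (this k (Finset.mem_univ k)).symm
  | succ d ih =>
    intro b hS hd
    obtain ⟨k, hk⟩ : ∃ k, blockSize b k < N k := by
      by_contra! hcon
      rw [Finset.sum_eq_zero (fun k _ => Nat.sub_eq_zero_of_le (hcon k))] at hd
      omega
    obtain ⟨l, hl⟩ : ∃ l, N l < blockSize b l := by
      by_contra! hcon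
      have := Finset.sum_lt_sum (fun j _ => hcon j) ⟨k, Finset.mem_univ k, hk⟩
      rw [hN, sum_blockSize] at this
      exact lt_irrefl _ this
    obtain ⟨v, hvl, hvS⟩ : ∃ v, b v = l ∧ v ∉ S := by
      by_contra! hcon
      have h1 : blockSize b l ≤ seedCount b S l := by
        refine Finset.card_le_card fun v hv => ?_
        have h2 := (Finset.mem_filter.1 hv).2
        exact Finset.mem_filter.2 ⟨hcon v h2, h2⟩
      have := hS l
      omega
    have hkl : b v ≠ k := by
      rintro rfl
      subst hvl
      omega
    have hbs := blockSize_update b v k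
    -- Move a nonseed from a block that is too large to one that is too small.
    set b' := Function.update b v k with hb'
    have hagree : ∀ i ∈ S, b' i = b i := fun i hi =>
      Function.update_of_ne (fun h : i = v => hvS (h ▸ hi)) _ _
    have hsc : ∀ j, seedCount b' S j = seedCount b S j := by
      intro j
      unfold seedCount
      congr 1
      refine Finset.filter_congr fun i hi => ?_
      rw [hagree i hi]
    obtain ⟨ψ, hψ, hcard⟩ := ih b' (fun j => (hsc j).trans_le (hS j)) (by
      have h1 : ∀ j, N j - blockSize b j = (N j - blockSize b' j) + if j = k then 1 else 0 := by
        intro j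
        have := hbs j
        rw [hvl] at this
        rcases eq_or_ne j k with rfl | hjk
        · rw [if_pos rfl, if_neg (by rintro rfl; exact hkl hvl)] at this
          rw [if_pos rfl]
          omega
        · rw [if_neg hjk] at this
          rw [if_neg hjk]
          rcases eq_or_ne j l with rfl | hjl
          · rw [if_pos rfl] at this
            omega
          · rw [if_neg hjl] at this
            omega
      simp_rw [h1] at hd
      rw [Finset.sum_add_distrib] at hd
      simp at hd
      exact hd)
    refine ⟨ψ, ⟨hψ.1, fun i hi => (hψ.2 i hi).trans (hagree i hi)⟩, ?_⟩
    calc (Sᶜ.filter fun w => ψ w ≠ b w).card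
        ≤ (insert v (Sᶜ.filter fun w => ψ w ≠ b' w)).card := by
          refine Finset.card_le_card fun w hw => ?_
          rw [Finset.mem_filter] at hw
          rw [Finset.mem_insert, Finset.mem_filter]
          by_cases hwv : w = v
          · exact Or.inl hwv
          · right
            refine ⟨hw.1, ?_⟩
            rw [hb', Function.update_of_ne hwv]
            exact hw.2
      _ ≤ _ := (Finset.card_insert_le _ _).trans (Nat.add_le_add_right hcard 1)

/-- A vertex is typical if the frequencies of its edges to the seeds of every block are close to
their means. -/
def TypicalVertex (Λ : Matrix (Fin K) (Fin K) ℝ) (b : Fin n → Fin K) (G : SimpleGraph (Fin n))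
    (S : Finset (Fin n)) (ε : ℝ) (v : Fin n) : Prop :=
  ∀ k, |(seedDegree b G S v k : ℝ) - Λ k (b v) * seedCount b S k| ≤ ε * seedCount b S k

open Classical in
/-- The number of nonseeds that are not typical. -/
def atypicalCount (Λ : Matrix (Fin K) (Fin K) ℝ) (b : Fin n → Fin K) (G : SimpleGraph (Fin n))
    (S : Finset (Fin n)) (ε : ℝ) : ℕ :=
  (Sᶜ.filter fun v => ¬TypicalVertex Λ b G S ε v).card

/-- The number of misclassified nonseeds, in terms of the number of atypical ones and the number
of block labels forced to be wrong by wrong block sizes. The maximizer `φ` is compared with the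
feasible assignment closest to the truth: every typical vertex that `φ` misclassifies costs at
least `κ` per seed, while any other deviation gains at most `B` per seed. -/
theorem exists_card_misclassified_le {Λ : Matrix (Fin K) (Fin K) ℝ}
    (hΛ : ∀ k l, 0 < Λ k l ∧ Λ k l < 1) (hdist : ∀ k l, k ≠ l → Λ k k ≠ Λ k l)
    {c : ℝ} (hc : 0 < c) :
    ∃ ε > 0, ∃ A ≥ 0, ∀ M : Matrix (Fin K) (Fin K) ℝ, (∀ k l, |M k l - Λ k l| ≤ ε) →
      Nondegenerate M ∧ ∀ (n : ℕ) (b : Fin n → Fin K) (G : SimpleGraph (Fin n))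
        (S : Finset (Fin n)) (N : Fin K → ℕ) (φ : Fin n → Fin K), 0 < S.card →
        (∀ k, c * S.card ≤ seedCount b S k) → ∑ k, N k = n → IsRestrictedMLE M N b G S φ →
        ((Sᶜ.filter fun v => φ v ≠ b v).card : ℝ) ≤
          A * (atypicalCount Λ b G S ε + ∑ k, |(N k : ℝ) - blockSize b k|) := by
  classical
  obtain ⟨ε, hε, κ, hκ, B, hB, hmain⟩ := exists_margin hΛ hdist hc
  refine ⟨ε, hε, (κ + B) / κ, by positivity, fun M hM => ?_⟩
  obtain ⟨hnd, hbound, hmargin⟩ := hmain M hM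
  refine ⟨hnd, fun n b G S N φ hS hcS hN hφ => ?_⟩
  have hSr : (0 : ℝ) < S.card := by exact_mod_cast hS
  have hpos : ∀ k, 0 < seedCount b S k := by
    intro k
    have : (0 : ℝ) < seedCount b S k := (mul_pos hc hSr).trans_le (hcS k)
    exact_mod_cast this
  have hsum : ∑ k, (seedCount b S k : ℝ) = S.card := by exact_mod_cast sum_seedCount b S
  have hany : ∀ v l l', -(B * S.card) ≤
      seedLogLik M b G S v l - seedLogLik M b G S v l' := by
    intro v l l'
    rw [seedLogLik_sub hpos, ← hsum, Finset.mul_sum, ← Finset.sum_neg_distrib]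
    refine Finset.sum_le_sum fun k _ => ?_
    have hk : (0 : ℝ) < seedCount b S k := by exact_mod_cast hpos k
    have := hbound ((seedDegree b G S v k : ℝ) / seedCount b S k) k l l' (by positivity)
      (div_le_one_of_le₀ (by exact_mod_cast seedDegree_le b G S v k) hk.le)
    nlinarith
  have htyp : ∀ v, TypicalVertex Λ b G S ε v → ∀ l, b v ≠ l →
      κ * S.card ≤ seedLogLik M b G S v (b v) - seedLogLik M b G S v l := by
    intro v hv l hl
    rw [seedLogLik_sub hpos]
    have := hmargin (b v) l hl (fun k => (seedDegree b G S v k : ℝ) / seedCount b S k)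
      (fun k => (seedCount b S k : ℝ)) (by simpa [hsum] using hcS) (fun k => by positivity)
      (fun k => by
        have hk : (0 : ℝ) < seedCount b S k := by exact_mod_cast hpos k
        have h1 := hv k
        have h2 : (seedDegree b G S v k : ℝ) / seedCount b S k - Λ k (b v) =
            ((seedDegree b G S v k : ℝ) - Λ k (b v) * seedCount b S k) / seedCount b S k := by
          field_simp
        rw [h2, abs_div, abs_of_pos hk, div_le_iff₀ hk]
        exact h1)
    rwa [hsum] at this
  obtain ⟨ψ, hψ, hψcard⟩ := exists_feasible_near hN (S := S) _ b (fun k => by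
    rw [← hφ.1.1 k]
    refine Finset.card_le_card fun i hi => ?_
    rw [Finset.mem_filter] at hi ⊢
    exact ⟨Finset.mem_univ i, (hφ.1.2 i hi.1).trans hi.2⟩) rfl
  have hψcard' : ((Sᶜ.filter fun v => ψ v ≠ b v).card : ℝ) ≤
      ∑ k, |(N k : ℝ) - blockSize b k| := by
    calc _ ≤ ((∑ k, (N k - blockSize b k) : ℕ) : ℝ) := by exact_mod_cast hψcard
      _ = ∑ k, ((N k - blockSize b k : ℕ) : ℝ) := by push_cast; rfl
      _ ≤ _ := by
        refine Finset.sum_le_sum fun k _ => ?_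
        rcases le_total (blockSize b k) (N k) with h | h
        · rw [Nat.cast_sub h]
          exact le_abs_self _
        · rw [Nat.sub_eq_zero_of_le h]
          simp
  have hle := hφ.sum_seedLogLik_le hnd hψ
  have hlow : (κ * S.card) * ((Sᶜ.filter fun v => φ v ≠ b v).card : ℝ) -
      ((κ + B) * S.card) * atypicalCount Λ b G S ε ≤
      ∑ v ∈ Sᶜ, (seedLogLik M b G S v (b v) - seedLogLik M b G S v (φ v)) := by
    rw [atypicalCount, ← Finset.sum_boole, ← Finset.sum_boole, Finset.mul_sum, Finset.mul_sum,
      ← Finset.sum_sub_distrib]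
    refine Finset.sum_le_sum fun v _ => ?_
    by_cases h1 : φ v = b v
    · rw [h1, sub_self]
      have : 0 ≤ (κ + B) * S.card := by positivity
      simp only [ne_eq, not_true_eq_false, if_false]
      split_ifs <;> linarith
    · by_cases h2 : TypicalVertex Λ b G S ε v
      · have := htyp v h2 (φ v) (Ne.symm h1)
        simpa [h1, h2] using this
      · have := hany v (b v) (φ v)
        simp only [ne_eq, h1, h2, not_false_eq_true, if_true]
        linarith
  have hup : ∑ v ∈ Sᶜ, (seedLogLik M b G S v (b v) - seedLogLik M b G S v (ψ v)) ≤
      (B * S.card) * ((Sᶜ.filter fun v => ψ v ≠ b v).card : ℝ) := by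
    rw [← Finset.sum_boole, Finset.mul_sum]
    refine Finset.sum_le_sum fun v _ => ?_
    by_cases h1 : ψ v = b v
    · simp [h1]
    · have := hany v (ψ v) (b v)
      simp only [ne_eq, h1, not_false_eq_true, if_true]
      linarith
  rw [Finset.sum_sub_distrib] at hlow hup
  have hfin : (κ * S.card) * ((Sᶜ.filter fun v => φ v ≠ b v).card : ℝ) ≤
      ((κ + B) * S.card) * (atypicalCount Λ b G S ε + ∑ k, |(N k : ℝ) - blockSize b k|) := by
    have h1 : (B * S.card) * ((Sᶜ.filter fun v => ψ v ≠ b v).card : ℝ) ≤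
        ((κ + B) * S.card) * ∑ k, |(N k : ℝ) - blockSize b k| := by
      gcongr
      linarith
    linarith
  rw [div_mul_eq_mul_div, le_div_iff₀ hκ]
  have h2 : (((Sᶜ.filter fun v => φ v ≠ b v).card : ℝ) * κ) * S.card ≤
      ((κ + B) * (atypicalCount Λ b G S ε + ∑ k, |(N k : ℝ) - blockSize b k|)) * S.card := by
    linarith
  exact le_of_mul_le_mul_right h2 hSr

/-! ### Typical seed sets and graphs -/

/-- The increasing ordered pair of two vertices. -/
def increasingPair (i j : Fin n) : Fin n × Fin n := if i < j then (i, j) else (j, i)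

theorem mk_increasingPair (i j : Fin n) :
    s((increasingPair i j).1, (increasingPair i j).2) = s(i, j) := by
  unfold increasingPair
  split_ifs
  · rfl
  · exact Sym2.eq_swap

theorem increasingPair_mem {i j : Fin n} (h : i ≠ j) : increasingPair i j ∈ vertexPairs n := by
  unfold increasingPair vertexPairs
  split_ifs with hij
  · simpa using hij
  · simpa using lt_of_le_of_ne (not_lt.1 hij) h.symm

open Classical in
theorem edgeDev_increasingPair {Λ : Matrix (Fin K) (Fin K) ℝ} (hsymm : Λ.IsSymm)
    (b : Fin n → Fin K) (G : SimpleGraph (Fin n)) (i j : Fin n) :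
    edgeDev Λ b G (increasingPair i j) = (if G.Adj i j then 1 else 0) - Λ (b i) (b j) := by
  unfold increasingPair edgeDev
  split_ifs <;> simp_all [G.adj_comm, hsymm.apply]

/-- The variance of the number of edges between a nonseed and the seeds of a block. -/
theorem sum_sbmProb_mul_seedDegree_sq_le {Λ : Matrix (Fin K) (Fin K) ℝ} (hsymm : Λ.IsSymm)
    (hΛ : ∀ k l, 0 < Λ k l ∧ Λ k l < 1) (b : Fin n → Fin K) {S : Finset (Fin n)} {v : Fin n}
    (hv : v ∉ S) (k : Fin K) :
    ∑ G : SimpleGraph (Fin n), sbmProb Λ b G *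
      ((seedDegree b G S v k : ℝ) - Λ k (b v) * seedCount b S k) ^ 2 ≤ seedCount b S k := by
  classical
  set s := S.filter fun i => b i = k with hs
  have hne : ∀ i ∈ s, i ≠ v := fun i hi h => hv (h ▸ (Finset.mem_filter.1 hi).1)
  have hinj : Set.InjOn (fun i => increasingPair i v) s := by
    intro i _ j _ hij
    have h1 := mk_increasingPair i v
    rw [show increasingPair i v = increasingPair j v from hij, mk_increasingPair] at h1
    exact (Sym2.congr_left.1 h1).symm
  have h := sum_sbmProb_mul_sq_le hΛ b (P := s.image fun i => increasingPair i v) (by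
    intro p hp
    obtain ⟨i, hi, rfl⟩ := Finset.mem_image.1 hp
    exact increasingPair_mem (hne i hi))
  rw [Finset.card_image_of_injOn hinj] at h
  refine le_trans (le_of_eq (Finset.sum_congr rfl fun G _ => ?_)) h
  rw [Finset.sum_image hinj]
  congr 2
  simp_rw [edgeDev_increasingPair hsymm]
  rw [Finset.sum_sub_distrib, Finset.sum_boole, hs, Finset.filter_filter]
  congr 1
  rw [Finset.sum_congr rfl (g := fun _ => Λ k (b v)) (fun i hi => by
    rw [(Finset.mem_filter.1 hi).2]), Finset.sum_const, nsmul_eq_mul, mul_comm]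
  rfl

/-- The potential edges that enter the estimate of the probability between blocks `k` and `l`. -/
def seedPairs (b : Fin n → Fin K) (S : Finset (Fin n)) (k l : Fin K) : Finset (Fin n × Fin n) :=
  (vertexPairs n).filter fun p => p.1 ∈ S ∧ p.2 ∈ S ∧
    (b p.1 = k ∧ b p.2 = l ∨ b p.1 = l ∧ b p.2 = k)

theorem mem_seedPairs {b : Fin n → Fin K} {S : Finset (Fin n)} {k l : Fin K}
    {p : Fin n × Fin n} : p ∈ seedPairs b S k l ↔ p.1 < p.2 ∧ p.1 ∈ S ∧ p.2 ∈ S ∧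
      (b p.1 = k ∧ b p.2 = l ∨ b p.1 = l ∧ b p.2 = k) := by
  simp [seedPairs, vertexPairs]

theorem card_seedPairs_of_ne (b : Fin n → Fin K) (S : Finset (Fin n)) {k l : Fin K}
    (h : k ≠ l) : (seedPairs b S k l).card = seedCount b S k * seedCount b S l := by
  unfold seedCount
  rw [← Finset.card_product]
  symm
  refine Finset.card_bij (fun p _ => increasingPair p.1 p.2) ?_ ?_ ?_
  · rintro ⟨i, j⟩ hp
    simp only [Finset.mem_product, Finset.mem_filter] at hp
    have hij : i ≠ j := by
      rintro rfl
      exact h (hp.1.2.symm.trans hp.2.2)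
    have h1 : (increasingPair i j).1 < (increasingPair i j).2 := by
      simpa [vertexPairs] using increasingPair_mem hij
    rw [mem_seedPairs]
    refine ⟨h1, ?_⟩
    unfold increasingPair
    split_ifs <;> simp [hp]
  · rintro ⟨i, j⟩ hp ⟨i', j'⟩ hp' heq
    simp only [Finset.mem_product, Finset.mem_filter] at hp hp'
    have h1 := mk_increasingPair i j
    rw [show increasingPair i j = increasingPair i' j' from heq, mk_increasingPair,
      Sym2.eq_iff] at h1
    rcases h1 with ⟨rfl, rfl⟩ | ⟨rfl, rfl⟩
    · rfl
    · exact absurd (hp'.1.2.symm.trans hp.2.2) h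
  · rintro ⟨i, j⟩ hp
    rw [mem_seedPairs] at hp
    obtain ⟨hlt, hi, hj, ⟨h1, h2⟩ | ⟨h1, h2⟩⟩ := hp
    · refine ⟨(i, j), by simp_all, ?_⟩
      simp only [increasingPair]
      rw [if_pos hlt]
    · refine ⟨(j, i), by simp_all, ?_⟩
      simp only [increasingPair]
      rw [if_neg (not_lt.2 hlt.le)]

theorem card_seedPairs_self (b : Fin n → Fin K) (S : Finset (Fin n)) (k : Fin K) :
    (seedPairs b S k k).card = (seedCount b S k).choose 2 := by
  classical
  set s := S.filter fun i => b i = k with hs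
  have hP : seedPairs b S k k = s.offDiag.filter fun p => p.1 < p.2 := by
    ext p
    rw [mem_seedPairs, Finset.mem_filter, Finset.mem_offDiag, hs, Finset.mem_filter,
      Finset.mem_filter]
    constructor
    · rintro ⟨h1, h2, h3, h4⟩
      exact ⟨⟨⟨h2, by tauto⟩, ⟨h3, by tauto⟩, h1.ne⟩, h1⟩
    · tauto
  have h1 := Finset.card_filter_add_card_filter_not (s := s.offDiag) (fun p => p.1 < p.2)
  have h2 : (s.offDiag.filter fun p => ¬p.1 < p.2).card =
      (s.offDiag.filter fun p => p.1 < p.2).card := by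
    refine Finset.card_bij' (fun p _ => p.swap) (fun p _ => p.swap) ?_ ?_ ?_ ?_
    · intro p hp
      simp only [Finset.mem_filter, Finset.mem_offDiag, Prod.fst_swap, Prod.snd_swap] at hp ⊢
      exact ⟨⟨hp.1.2.1, hp.1.1, hp.1.2.2.symm⟩, lt_of_le_of_ne (not_lt.1 hp.2) hp.1.2.2.symm⟩
    · intro p hp
      simp only [Finset.mem_filter, Finset.mem_offDiag, Prod.fst_swap, Prod.snd_swap] at hp ⊢
      exact ⟨⟨hp.1.2.1, hp.1.1, hp.1.2.2.symm⟩, not_lt.2 hp.2.le⟩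
    · simp
    · simp
  rw [h2, Finset.offDiag_card] at h1
  have h3 : seedCount b S k = s.card := rfl
  rw [hP, h3, Nat.choose_two_right, Nat.mul_sub_one]
  omega

open Classical in
theorem lambdaHat_eq (b : Fin n → Fin K) (G : SimpleGraph (Fin n)) (S : Finset (Fin n))
    (k l : Fin K) : lambdaHat b G S k l =
      (∑ p ∈ seedPairs b S k l, if G.Adj p.1 p.2 then (1 : ℝ) else 0) /
        (seedPairs b S k l).card := by
  have hden : (if k = l then ((seedCount b S k).choose 2 : ℝ)
      else (seedCount b S k : ℝ) * (seedCount b S l : ℝ)) = (seedPairs b S k l).card := by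
    split_ifs with h
    · subst h
      rw [card_seedPairs_self]
    · rw [card_seedPairs_of_ne b S h]
      push_cast
      rfl
  unfold lambdaHat
  rw [hden, Finset.sum_boole]
  congr 2
  symm
  refine Finset.card_bij (fun p _ => s(p.1, p.2)) ?_ ?_ ?_
  · intro p hp
    rw [Finset.mem_filter, mem_seedPairs] at hp
    obtain ⟨⟨_, hi, hj, h | h⟩, hadj⟩ := hp
    · simp only [Finset.mem_filter, SimpleGraph.mem_edgeFinset, SimpleGraph.mem_edgeSet]
      exact ⟨hadj, p.1, hi, p.2, hj, h.1, h.2, rfl⟩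
    · simp only [Finset.mem_filter, SimpleGraph.mem_edgeFinset, SimpleGraph.mem_edgeSet]
      exact ⟨hadj, p.2, hj, p.1, hi, h.2, h.1, Sym2.eq_swap⟩
  · intro p hp q hq h
    rw [Finset.mem_filter, mem_seedPairs] at hp hq
    rw [Sym2.eq_iff] at h
    rcases h with h | h
    · exact Prod.ext h.1 h.2
    · have h1 := hp.1.1
      have h2 := hq.1.1
      rw [h.1, h.2] at h1
      exact absurd h1 h2.asymm
  · intro e he
    simp only [Finset.mem_filter, SimpleGraph.mem_edgeFinset] at he
    obtain ⟨hadj, i, hi, j, hj, hbi, hbj, rfl⟩ := he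
    rw [SimpleGraph.mem_edgeSet] at hadj
    refine ⟨increasingPair i j, ?_, mk_increasingPair i j⟩
    have h1 : (increasingPair i j).1 < (increasingPair i j).2 := by
      simpa [vertexPairs] using increasingPair_mem hadj.ne
    rw [Finset.mem_filter, mem_seedPairs]
    refine ⟨⟨h1, ?_⟩, ?_⟩
    · unfold increasingPair
      split_ifs <;> simp [hi, hj, hbi, hbj]
    · unfold increasingPair
      split_ifs
      · exact hadj
      · exact hadj.symm

/-- The mean square error of the estimated edge probabilities, for a given seed set. -/
theorem sum_sbmProb_mul_lambdaHat_sq_le {Λ : Matrix (Fin K) (Fin K) ℝ} (hsymm : Λ.IsSymm)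
    (hΛ : ∀ k l, 0 < Λ k l ∧ Λ k l < 1) (b : Fin n → Fin K) {S : Finset (Fin n)} {k l : Fin K}
    (hP : 0 < (seedPairs b S k l).card) :
    ∑ G : SimpleGraph (Fin n), sbmProb Λ b G * (lambdaHat b G S k l - Λ k l) ^ 2 ≤
      1 / (seedPairs b S k l).card := by
  classical
  have hP' : (0 : ℝ) < (seedPairs b S k l).card := by exact_mod_cast hP
  have h1 : ∀ G : SimpleGraph (Fin n), lambdaHat b G S k l - Λ k l =
      (∑ p ∈ seedPairs b S k l, edgeDev Λ b G p) / (seedPairs b S k l).card := by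
    intro G
    rw [lambdaHat_eq, div_sub' hP'.ne', ← nsmul_eq_mul, ← Finset.sum_const,
      ← Finset.sum_sub_distrib]
    congr 1
    refine Finset.sum_congr rfl fun p hp => ?_
    rw [mem_seedPairs] at hp
    unfold edgeDev
    congr 1
    obtain ⟨_, _, _, h | h⟩ := hp
    · rw [h.1, h.2]
    · rw [h.1, h.2, hsymm.apply]
  simp_rw [h1, div_pow, mul_div_assoc']
  rw [← Finset.sum_div, div_le_div_iff₀ (by positivity) hP']
  have := sum_sbmProb_mul_sq_le hΛ b (P := seedPairs b S k l) (Finset.filter_subset _ _)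
  nlinarith

theorem seedCount_sub_one_le_card_seedPairs {b : Fin n → Fin K} {S : Finset (Fin n)}
    (hS : ∀ k, 1 ≤ seedCount b S k) (k l : Fin K) :
    seedCount b S k ≤ (seedPairs b S k l).card + 1 := by
  rcases eq_or_ne k l with rfl | h
  · rw [card_seedPairs_self]
    have h1 := Nat.add_one_mul_choose_eq (seedCount b S k - 1) 1
    have := hS k
    rw [Nat.sub_add_cancel this] at h1
    simp only [Nat.choose_one_right, Nat.reduceAdd] at h1
    obtain ⟨r, hr⟩ : ∃ r, seedCount b S k = r + 1 := ⟨_, (Nat.sub_add_cancel this).symm⟩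
    rw [hr] at h1 ⊢
    simp only [Nat.add_sub_cancel] at h1
    rcases r with _ | r
    · omega
    · nlinarith
  · rw [card_seedPairs_of_ne b S h]
    have := Nat.le_mul_of_pos_right (seedCount b S k) (hS l)
    omega

/-- Given a seed set with many seeds in each block, with high probability the estimated edge
probabilities are accurate and few nonseeds are atypical. -/
theorem le_sum_sbmProb_mul {Λ : Matrix (Fin K) (Fin K) ℝ} (hsymm : Λ.IsSymm)
    (hΛ : ∀ k l, 0 < Λ k l ∧ Λ k l < 1) {b : Fin n → Fin K} {S : Finset (Fin n)}
    {x ε ε' ζ : ℝ} (hx : 2 ≤ x) (hε : 0 < ε) (hε' : 0 < ε') (hζ : 0 ≤ ζ)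
    (hS : ∀ k, x ≤ seedCount b S k) (hu : 0 < Sᶜ.card) {f : SimpleGraph (Fin n) → ℝ}
    (hf0 : ∀ G, 0 ≤ f G)
    (hf : ∀ G, (∀ k l, |lambdaHat b G S k l - Λ k l| ≤ ε) →
      (atypicalCount Λ b G S ε : ℝ) ≤ ε' * Sᶜ.card → 1 - ζ ≤ f G) :
    1 - ζ - (2 * K ^ 2 / ε ^ 2 + K / (ε ^ 2 * ε')) / x ≤
      ∑ G : SimpleGraph (Fin n), sbmProb Λ b G * f G := by
  classical
  have hu' : (0 : ℝ) < Sᶜ.card := by exact_mod_cast hu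
  have hx0 : 0 < x := by linarith
  have hpos : ∀ k, 0 < (seedCount b S k : ℝ) := fun k => by linarith [hS k]
  have hone : ∀ k, 1 ≤ seedCount b S k := fun k => by exact_mod_cast hpos k
  set Y : SimpleGraph (Fin n) → ℝ := fun G =>
    ∑ k, ∑ l, (lambdaHat b G S k l - Λ k l) ^ 2 / ε ^ 2 with hY
  set Z : SimpleGraph (Fin n) → ℝ := fun G => ∑ v ∈ Sᶜ, ∑ k,
    ((seedDegree b G S v k : ℝ) - Λ k (b v) * seedCount b S k) ^ 2 /
      (ε * seedCount b S k) ^ 2 with hZ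
  have hEY : ∑ G : SimpleGraph (Fin n), sbmProb Λ b G * Y G ≤ 2 * K ^ 2 / ε ^ 2 / x := by
    calc _ = ∑ k, ∑ l, (∑ G : SimpleGraph (Fin n),
          sbmProb Λ b G * (lambdaHat b G S k l - Λ k l) ^ 2) / ε ^ 2 := by
          simp_rw [hY, Finset.mul_sum, Finset.sum_div]
          rw [Finset.sum_comm]
          refine Finset.sum_congr rfl fun k _ => ?_
          rw [Finset.sum_comm]
          simp_rw [mul_div_assoc]
      _ ≤ ∑ k : Fin K, ∑ l : Fin K, (2 / x) / ε ^ 2 := by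
          refine Finset.sum_le_sum fun k _ => Finset.sum_le_sum fun l _ => ?_
          have h1 : (seedCount b S k : ℝ) ≤ (seedPairs b S k l).card + 1 := by
            exact_mod_cast seedCount_sub_one_le_card_seedPairs hone k l
          have h2 : x / 2 ≤ (seedPairs b S k l).card := by linarith [hS k]
          have h3 : (0 : ℝ) < (seedPairs b S k l).card := by linarith
          refine div_le_div_of_nonneg_right ?_ (by positivity)
          refine (sum_sbmProb_mul_lambdaHat_sq_le hsymm hΛ b (by exact_mod_cast h3)).trans ?_
          rw [div_le_div_iff₀ h3 hx0]
          linarith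
      _ = _ := by
          simp only [Finset.sum_const, Finset.card_univ, Fintype.card_fin, nsmul_eq_mul]
          field_simp
  have hEZ : ∑ G : SimpleGraph (Fin n), sbmProb Λ b G * Z G ≤
      Sᶜ.card * (K / ε ^ 2 / x) := by
    calc _ = ∑ v ∈ Sᶜ, ∑ k, (∑ G : SimpleGraph (Fin n), sbmProb Λ b G *
          ((seedDegree b G S v k : ℝ) - Λ k (b v) * seedCount b S k) ^ 2) /
            (ε * seedCount b S k) ^ 2 := by
          simp_rw [hZ, Finset.mul_sum, Finset.sum_div]
          rw [Finset.sum_comm]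
          refine Finset.sum_congr rfl fun k _ => ?_
          rw [Finset.sum_comm]
          simp_rw [mul_div_assoc]
      _ ≤ ∑ v ∈ Sᶜ, ∑ k : Fin K, 1 / ε ^ 2 / x := by
          refine Finset.sum_le_sum fun v hv => Finset.sum_le_sum fun k _ => ?_
          refine (div_le_div_of_nonneg_right (sum_sbmProb_mul_seedDegree_sq_le hsymm hΛ b
            (Finset.mem_compl.1 hv) k) (by positivity)).trans ?_
          have h1 := hpos k
          rw [div_div, div_le_div_iff₀ (by positivity) (by positivity)]
          have h2 : ε ^ 2 * seedCount b S k * x ≤ ε ^ 2 * seedCount b S k * seedCount b S k := by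
            gcongr
            exact hS k
          nlinarith
      _ = _ := by
          simp only [Finset.sum_const, Finset.card_univ, Fintype.card_fin, nsmul_eq_mul]
          ring
  -- Outside the good event, `Y G` or `Z G / (ε' * u)` is at least `1`.
  have hpt : ∀ G, 1 - ζ - Y G - Z G / (ε' * Sᶜ.card) ≤ f G := by
    intro G
    have hY0 : 0 ≤ Y G := Finset.sum_nonneg fun k _ => Finset.sum_nonneg fun l _ => by positivity
    have hZ0 : 0 ≤ Z G := Finset.sum_nonneg fun k _ => Finset.sum_nonneg fun l _ => by positivity
    have hZ0' : 0 ≤ Z G / (ε' * Sᶜ.card) := by positivity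
    by_cases h1 : ∀ k l, |lambdaHat b G S k l - Λ k l| ≤ ε
    · by_cases h2 : (atypicalCount Λ b G S ε : ℝ) ≤ ε' * Sᶜ.card
      · linarith [hf G h1 h2]
      · have h3 : (atypicalCount Λ b G S ε : ℝ) ≤ Z G := by
          rw [atypicalCount, ← Finset.sum_boole]
          refine Finset.sum_le_sum fun v _ => ?_
          split_ifs with h
          · exact Finset.sum_nonneg fun k _ => by positivity
          · simp only [TypicalVertex, not_forall, not_le] at h
            obtain ⟨k, hk⟩ := h
            refine le_trans ?_ (Finset.single_le_sum
              (f := fun k => ((seedDegree b G S v k : ℝ) - Λ k (b v) * seedCount b S k) ^ 2 /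
                (ε * seedCount b S k) ^ 2) (fun k _ => by positivity) (Finset.mem_univ k))
            have := hpos k
            rw [one_le_div (by positivity), ← sq_abs ((seedDegree b G S v k : ℝ) - _)]
            gcongr
        have h4 : 1 ≤ Z G / (ε' * Sᶜ.card) := by
          rw [one_le_div (by positivity)]
          linarith
        linarith [hf0 G]
    · push Not at h1
      obtain ⟨k, l, hkl⟩ := h1
      have h3 : 1 ≤ Y G := by
        have h4 : 1 ≤ (lambdaHat b G S k l - Λ k l) ^ 2 / ε ^ 2 := by
          rw [one_le_div (by positivity), ← sq_abs (lambdaHat b G S k l - _)]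
          gcongr
        refine h4.trans ((Finset.single_le_sum
          (f := fun l => (lambdaHat b G S k l - Λ k l) ^ 2 / ε ^ 2)
          (fun l _ => by positivity) (Finset.mem_univ l)).trans ?_)
        exact Finset.single_le_sum
          (f := fun k => ∑ l, (lambdaHat b G S k l - Λ k l) ^ 2 / ε ^ 2)
          (fun k _ => Finset.sum_nonneg fun l _ => by positivity) (Finset.mem_univ k)
      linarith [hf0 G]
  calc _ ≤ (1 - ζ) - (∑ G : SimpleGraph (Fin n), sbmProb Λ b G * Y G) -
        (∑ G : SimpleGraph (Fin n), sbmProb Λ b G * Z G) / (ε' * Sᶜ.card) := by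
        have h1 : (∑ G : SimpleGraph (Fin n), sbmProb Λ b G * Z G) / (ε' * Sᶜ.card) ≤
            K / (ε ^ 2 * ε') / x := by
          rw [div_le_iff₀ (by positivity)]
          refine hEZ.trans (le_of_eq ?_)
          field_simp
        rw [add_div]
        linarith
    _ = ∑ G : SimpleGraph (Fin n), sbmProb Λ b G *
        (1 - ζ - Y G - Z G / (ε' * Sᶜ.card)) := by
        simp_rw [mul_sub, Finset.sum_sub_distrib, mul_div_assoc']
        simp_rw [mul_one]
        rw [← Finset.sum_div, ← Finset.sum_mul, sum_sbmProb]
        ring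
    _ ≤ _ := Finset.sum_le_sum fun G _ =>
        mul_le_mul_of_nonneg_left (hpt G) (sbmProb_nonneg hΛ b G)

/-- A seed set is balanced if it contains about the expected number of vertices of every block;
with `m` seeds and `u` nonseeds, the error is at most `δ` times `m * u / n`, which is at most `δ`
times the smaller of `m` and `u`. -/
def BalancedSeeds (b : Fin n → Fin K) (S : Finset (Fin n)) (δ : ℝ) : Prop :=
  ∀ k, |(seedCount b S k : ℝ) - S.card * blockSize b k / n| ≤
    δ * ((S.card : ℝ) * Sᶜ.card / n)

theorem expectation_eq (Λ : Matrix (Fin K) (Fin K) ℝ) (b : Fin n → Fin K) (m : ℕ)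
    (f : SimpleGraph (Fin n) → Finset (Fin n) → ℝ) :
    expectation Λ b m f = ∑ S ∈ Finset.powersetCard m (Finset.univ : Finset (Fin n)),
      (1 / (n.choose m : ℝ)) * ∑ G : SimpleGraph (Fin n), sbmProb Λ b G * f G S := by
  unfold expectation
  rw [Finset.sum_comm]
  refine Finset.sum_congr rfl fun S _ => ?_
  rw [Finset.mul_sum]
  exact Finset.sum_congr rfl fun G _ => by ring

theorem sum_powersetCard_one_div_choose {m : ℕ} (hm : m ≤ n) :
    ∑ _S ∈ Finset.powersetCard m (Finset.univ : Finset (Fin n)), 1 / (n.choose m : ℝ) = 1 := by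
  have : (n.choose m : ℝ) ≠ 0 := by exact_mod_cast (Nat.choose_pos hm).ne'
  simp [this]

/-- With high probability, the seed set is balanced, the estimated edge probabilities are
accurate and few nonseeds are atypical, as soon as there are many seeds and many nonseeds. -/
theorem exists_le_expectation {Λ : Matrix (Fin K) (Fin K) ℝ} (hsymm : Λ.IsSymm)
    (hΛ : ∀ k l, 0 < Λ k l ∧ Λ k l < 1) {c δ ε ε' ζ : ℝ} (hc : 0 < c) (hδ : 0 < δ) (hδc : δ ≤ c)
    (hε : 0 < ε) (hε' : 0 < ε') (hζ : 0 < ζ) :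
    ∃ R : ℕ, 0 < R ∧ ∀ (n : ℕ) (b : Fin n → Fin K) (m : ℕ), (∀ k, 2 * c * n ≤ blockSize b k) →
      R ≤ m → m + R ≤ n → ∀ f : SimpleGraph (Fin n) → Finset (Fin n) → ℝ, (∀ G S, 0 ≤ f G S) →
      (∀ G S, S.card = m → BalancedSeeds b S δ → (∀ k, c * m ≤ seedCount b S k) →
        (∀ k l, |lambdaHat b G S k l - Λ k l| ≤ ε) →
        (atypicalCount Λ b G S ε : ℝ) ≤ ε' * Sᶜ.card → 1 - ζ ≤ f G S) →
      1 - 2 * ζ ≤ expectation Λ b m f := by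
  classical
  set a : ℝ := (2 * K ^ 2 / ε ^ 2 + K / (ε ^ 2 * ε')) / c with ha
  set a' : ℝ := 4 * K / δ ^ 2 with ha'
  have ha0 : 0 ≤ a := by positivity
  have ha'0 : 0 ≤ a' := by positivity
  obtain ⟨R, hR⟩ := exists_nat_ge (2 / c + (a + a') / ζ + 1)
  have hRpos : (1 : ℝ) ≤ R := by
    have : 0 ≤ 2 / c := by positivity
    have : 0 ≤ (a + a') / ζ := by positivity
    linarith
  refine ⟨R, by exact_mod_cast hRpos, fun n b m hb hRm hmR f hf0 hf => ?_⟩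
  have hmn : m ≤ n := by omega
  have hRm' : (R : ℝ) ≤ m := by exact_mod_cast hRm
  set u : ℝ := ((n - m : ℕ) : ℝ) with hu
  have hRu : (R : ℝ) ≤ u := by
    rw [hu]
    exact_mod_cast (by omega : R ≤ n - m)
  have hnmu : (n : ℝ) = m + u := by
    rw [hu, Nat.cast_sub hmn]
    ring
  have hm0 : (0 : ℝ) < m := by linarith
  have hu0 : 0 < u := by linarith
  have hn0 : (0 : ℝ) < n := by linarith
  have hR0 : (0 : ℝ) < R := by linarith
  set h : Finset (Fin n) → ℝ := fun S => ∑ k,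
    ((seedCount b S k : ℝ) - m * blockSize b k / n) ^ 2 / (δ * (m * u / n)) ^ 2 with hh
  have hEh : ∑ S ∈ Finset.powersetCard m (Finset.univ : Finset (Fin n)),
      (1 / (n.choose m : ℝ)) * h S ≤ a' / R := by
    have hkey : ∀ k, ∑ S ∈ Finset.powersetCard m (Finset.univ : Finset (Fin n)),
        (1 / (n.choose m : ℝ)) * (((seedCount b S k : ℝ) - m * blockSize b k / n) ^ 2 /
          (δ * (m * u / n)) ^ 2) ≤ 4 / δ ^ 2 / R := by
      intro k
      rw [Finset.sum_congr rfl fun S _ => (mul_div_assoc _ _ _).symm, ← Finset.sum_div,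
        div_le_iff₀ (by positivity)]
      have hRpos' : 1 ≤ R := by exact_mod_cast hRpos
      refine (sum_seedCount_sq_le b (hRpos'.trans hRm) (by omega) k).trans ?_
      rw [← hu]
      have h1 : n * R ≤ 2 * (m * u) := by
        rw [hnmu]
        nlinarith
      have h2 : 4 / δ ^ 2 / R * (δ * (m * u / n)) ^ 2 = (m * u / n) * (4 * (m * u) / (n * R)) := by
        field_simp
      rw [h2, mul_comm 2]
      gcongr
      rw [le_div_iff₀ (by positivity)]
      linarith
    simp_rw [hh, Finset.mul_sum]
    rw [Finset.sum_comm]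
    refine (Finset.sum_le_sum fun k _ => hkey k).trans (le_of_eq ?_)
    simp only [Finset.sum_const, Finset.card_univ, Fintype.card_fin, nsmul_eq_mul, ha']
    ring
  -- If `S` is not balanced, `h S` is at least `1`.
  have hpt : ∀ S ∈ Finset.powersetCard m (Finset.univ : Finset (Fin n)),
      1 - ζ - a / R - h S ≤ ∑ G : SimpleGraph (Fin n), sbmProb Λ b G * f G S := by
    intro S hS
    rw [Finset.mem_powersetCard] at hS
    have hScard : (Sᶜ.card : ℝ) = u := by rw [Finset.card_compl, hS.2, Fintype.card_fin]
    have hh0 : 0 ≤ h S := Finset.sum_nonneg fun k _ => by positivity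
    have haR : 0 ≤ a / R := by positivity
    by_cases hbal : BalancedSeeds b S δ
    · have hcm : ∀ k, c * m ≤ seedCount b S k := by
        intro k
        have h1 := (abs_le.1 (hbal k)).1
        rw [hS.2, hScard] at h1
        have h2 : 2 * c * m ≤ m * blockSize b k / n := by
          rw [le_div_iff₀ hn0]
          have := hb k
          nlinarith
        have h3 : δ * (m * u / n) ≤ c * m := by
          have : m * u / n ≤ m := by
            rw [div_le_iff₀ hn0]
            nlinarith
          exact mul_le_mul hδc this (by positivity) hc.le
        linarith
      have h1 := le_sum_sbmProb_mul hsymm hΛ (b := b) (S := S) (x := c * m) (ε := ε) (ε' := ε')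
        (ζ := ζ) (f := fun G => f G S) (by
          have : 2 / c ≤ m := by
            have : 0 ≤ (a + a') / ζ := by positivity
            linarith
          rw [div_le_iff₀ hc] at this
          linarith) hε hε' hζ.le hcm (by
            have : (0 : ℝ) < Sᶜ.card := by rw [hScard]; exact hu0
            exact_mod_cast this) (fun G => hf0 G S) (fun G hG1 hG2 => hf G S hS.2 hbal hcm hG1 hG2)
      have h2 : (2 * K ^ 2 / ε ^ 2 + K / (ε ^ 2 * ε')) / (c * m) ≤ a / R := by
        rw [← div_div, ← ha]
        gcongr
      linarith
    · have h1 : 1 ≤ h S := by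
        simp only [BalancedSeeds, not_forall, not_le] at hbal
        obtain ⟨k, hk⟩ := hbal
        rw [hS.2, hScard] at hk
        refine le_trans ?_ (Finset.single_le_sum (f := fun k =>
          ((seedCount b S k : ℝ) - m * blockSize b k / n) ^ 2 / (δ * (m * u / n)) ^ 2)
          (fun k _ => by positivity) (Finset.mem_univ k))
        rw [one_le_div (by positivity), ← sq_abs ((seedCount b S k : ℝ) - _)]
        gcongr
      have h2 : 0 ≤ ∑ G : SimpleGraph (Fin n), sbmProb Λ b G * f G S :=
        Finset.sum_nonneg fun G _ => mul_nonneg (sbmProb_nonneg hΛ b G) (hf0 G S)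
      linarith
  rw [expectation_eq]
  calc 1 - 2 * ζ ≤ 1 - ζ - a / R - a' / R := by
        have : a / R + a' / R ≤ ζ := by
          rw [← add_div, div_le_iff₀ hR0]
          have h1 : (a + a') / ζ ≤ R := by
            have : 0 ≤ 2 / c := by positivity
            linarith
          rw [div_le_iff₀ hζ] at h1
          linarith
        linarith
    _ ≤ (1 - ζ - a / R) * ∑ _S ∈ Finset.powersetCard m (Finset.univ : Finset (Fin n)),
          1 / (n.choose m : ℝ) - ∑ S ∈ Finset.powersetCard m (Finset.univ : Finset (Fin n)),
          (1 / (n.choose m : ℝ)) * h S := by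
        rw [sum_powersetCard_one_div_choose hmn]
        linarith
    _ = ∑ S ∈ Finset.powersetCard m (Finset.univ : Finset (Fin n)),
          (1 / (n.choose m : ℝ)) * (1 - ζ - a / R - h S) := by
        rw [Finset.mul_sum, ← Finset.sum_sub_distrib]
        exact Finset.sum_congr rfl fun S _ => by ring
    _ ≤ _ := Finset.sum_le_sum fun S hS =>
        mul_le_mul_of_nonneg_left (hpt S hS) (by positivity)

/-! ### Optimality of the canonical scheme -/

theorem targetCount_add_seedCount [NeZero K] (b : Fin n → Fin K) (S : Finset (Fin n)) :
    targetCount b S + seedCount b S 0 = blockSize b 0 := by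
  classical
  unfold targetCount seedCount blockSize
  rw [add_comm, ← Finset.card_union_of_disjoint
    (Finset.disjoint_filter_filter disjoint_compl_right), ← Finset.filter_union,
    Finset.union_compl]

theorem Feasible.seedCount_eq {N : Fin K → ℕ} {b φ : Fin n → Fin K} {S : Finset (Fin n)}
    (h : Feasible N b S φ) (k : Fin K) : seedCount φ S k = seedCount b S k := by
  unfold seedCount
  congr 1
  exact Finset.filter_congr fun i hi => by rw [h.2 i hi]

theorem Feasible.targetCount_eq [NeZero K] {b φ : Fin n → Fin K} {S : Finset (Fin n)}
    (h : Feasible (blockSize b) b S φ) : targetCount φ S = targetCount b S := by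
  have h1 := targetCount_add_seedCount φ S
  have h2 := targetCount_add_seedCount b S
  rw [h.seedCount_eq, h.1] at h1
  omega

/-- Among all lists, one in the order of decreasing weight has the heaviest initial segments. -/
theorem sum_prefix_le_of_antitone {S : Finset (Fin n)} {p : {v : Fin n // v ∉ S} → ℝ}
    {L' : NominationList S} (hL' : ∀ v w, p w < p v → L' v < L' w) (L : NominationList S)
    (i : ℕ) : ∑ v ∈ Finset.univ.filter (fun v => (L v : ℕ) < i), p v ≤
      ∑ v ∈ Finset.univ.filter (fun v => (L' v : ℕ) < i), p v := by
  classical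
  set A := Finset.univ.filter fun v => (L' v : ℕ) < i with hA
  set B := Finset.univ.filter fun v => (L v : ℕ) < i with hB
  have hcard : (B \ A).card = (A \ B).card :=
    (Finset.card_sdiff_comm ((card_prefix L i).trans (card_prefix L' i).symm))
  have hcmp : ∀ x ∈ A \ B, ∀ y ∈ B \ A, p y ≤ p x := by
    intro x hx y hy
    simp only [Finset.mem_sdiff, hA, hB, Finset.mem_filter, Finset.mem_univ, true_and] at hx hy
    by_contra! hlt
    have h1 : (L' y : ℕ) < L' x := hL' y x hlt
    omega
  have hmain : ∑ v ∈ B \ A, p v ≤ ∑ v ∈ A \ B, p v := by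
    rcases (B \ A).eq_empty_or_nonempty with h | h
    · rw [h, Finset.card_empty] at hcard
      rw [h, Finset.card_eq_zero.1 hcard.symm]
    · obtain ⟨y, hy, hmax⟩ := Finset.exists_max_image _ p h
      calc _ ≤ (B \ A).card • p y := Finset.sum_le_card_nsmul _ _ _ hmax
        _ = (A \ B).card • p y := by rw [hcard]
        _ ≤ _ := Finset.card_nsmul_le_sum _ _ _ fun x hx => hcmp x hx y hy
  rw [← Finset.sum_inter_add_sum_sdiff B A, ← Finset.sum_inter_add_sum_sdiff A B,
    Finset.inter_comm]
  linarith

open Classical in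
/-- The assignments that are indistinguishable from `b` without the graph: they have the same
block sizes and agree with `b` on the seeds. -/
def candidates (b : Fin n → Fin K) (S : Finset (Fin n)) : Finset (Fin n → Fin K) :=
  Finset.univ.filter fun φ => Feasible (blockSize b) b S φ

theorem mem_candidates {b φ : Fin n → Fin K} {S : Finset (Fin n)} :
    φ ∈ candidates b S ↔ Feasible (blockSize b) b S φ := by
  simp [candidates]

/-- The average precision, averaged over the candidates weighted by their likelihoods, in terms
of the posterior probabilities. -/
theorem sum_candidates_averagePrecision [NeZero K] {Λ : Matrix (Fin K) (Fin K) ℝ}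
    (hΛ : ∀ k l, 0 < Λ k l ∧ Λ k l < 1) (b : Fin n → Fin K) (G : SimpleGraph (Fin n))
    (S : Finset (Fin n)) (L : NominationList S) :
    ∑ φ ∈ candidates b S, sbmProb Λ φ G * averagePrecision φ S L =
      (∑ φ ∈ candidates b S, sbmProb Λ φ G) * ((1 / (targetCount b S : ℝ)) *
        ∑ i ∈ Finset.Icc 1 (targetCount b S), (∑ v ∈ Finset.univ.filter
          (fun v : {v : Fin n // v ∉ S} => (L v : ℕ) < i), posterior Λ b G S v) / i) := by
  classical
  have hZ : (∑ φ ∈ candidates b S, sbmProb Λ φ G) ≠ 0 := by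
    refine (Finset.sum_pos (fun φ _ => sbmProb_pos hΛ φ G) ⟨b, ?_⟩).ne'
    rw [mem_candidates]
    exact ⟨fun _ => rfl, fun _ _ => rfl⟩
  have hpost : ∀ v : {v : Fin n // v ∉ S}, (∑ φ ∈ candidates b S, sbmProb Λ φ G) *
      posterior Λ b G S v = ∑ φ ∈ candidates b S, if φ v = 0 then sbmProb Λ φ G else 0 := by
    intro v
    unfold posterior
    rw [show (Finset.univ.filter fun φ : Fin n → Fin K => Feasible (blockSize b) b S φ) =
      candidates b S from rfl, mul_div_cancel₀ _ hZ, ← Finset.sum_filter, candidates,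
      Finset.filter_filter]
  have hcount : ∀ φ ∈ candidates b S, sbmProb Λ φ G * averagePrecision φ S L =
      (1 / (targetCount b S : ℝ)) * ∑ i ∈ Finset.Icc 1 (targetCount b S),
        (∑ v ∈ Finset.univ.filter (fun v : {v : Fin n // v ∉ S} => (L v : ℕ) < i),
          if φ v = 0 then sbmProb Λ φ G else 0) / i := by
    intro φ hφ
    rw [averagePrecision_eq, (mem_candidates.1 hφ).targetCount_eq, mul_left_comm,
      Finset.mul_sum]
    congr 1
    refine Finset.sum_congr rfl fun i _ => ?_
    rw [← mul_div_assoc, prefixHits, ← Finset.sum_filter, Finset.sum_const, nsmul_eq_mul,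
      Finset.filter_filter, mul_comm]
  rw [Finset.sum_congr rfl hcount, ← Finset.mul_sum, mul_left_comm, Finset.sum_comm]
  congr 1
  rw [Finset.mul_sum]
  refine Finset.sum_congr rfl fun i _ => ?_
  rw [← Finset.sum_div, ← mul_div_assoc, Finset.mul_sum, Finset.sum_comm]
  refine congrArg (· / (i : ℝ)) ?_
  exact Finset.sum_congr rfl fun v _ => (hpost v).symm

theorem sum_candidates_averagePrecision_le [NeZero K] {Λ : Matrix (Fin K) (Fin K) ℝ}
    (hΛ : ∀ k l, 0 < Λ k l ∧ Λ k l < 1) {b : Fin n → Fin K} {G : SimpleGraph (Fin n)}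
    {S : Finset (Fin n)} {L' : NominationList S} (hL' : IsCanonicalList Λ b G S L')
    (L : NominationList S) :
    ∑ φ ∈ candidates b S, sbmProb Λ φ G * averagePrecision φ S L ≤
      ∑ φ ∈ candidates b S, sbmProb Λ φ G * averagePrecision φ S L' := by
  rw [sum_candidates_averagePrecision hΛ, sum_candidates_averagePrecision hΛ]
  refine mul_le_mul_of_nonneg_left ?_ (Finset.sum_nonneg fun φ _ => sbmProb_nonneg hΛ φ G)
  refine mul_le_mul_of_nonneg_left ?_ (by positivity)
  refine Finset.sum_le_sum fun i _ => ?_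
  refine div_le_div_of_nonneg_right ?_ (by positivity)
  exact sum_prefix_le_of_antitone (S := S) (p := fun v => posterior Λ b G S v.1) (L' := L') hL' L i

/-- Bayes optimality of the canonical scheme: average precision is linear in the indicators of
membership in the block of interest, so its posterior mean is maximal for lists in the order of
decreasing posterior probability. -/
theorem sum_candidates_meanAP_le [NeZero K] {Λ : Matrix (Fin K) (Fin K) ℝ}
    (hΛ : ∀ k l, 0 < Λ k l ∧ Λ k l < 1) (b : Fin n → Fin K) (G : SimpleGraph (Fin n))
    (S : Finset (Fin n)) (P : NominationList S → Prop) :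
    ∑ φ ∈ candidates b S, sbmProb Λ φ G * meanAP φ S P ≤
      ∑ φ ∈ candidates b S, sbmProb Λ φ G * meanAP φ S (IsCanonicalList Λ b G S) := by
  classical
  have hswap : ∀ P : NominationList S → Prop,
      ∑ φ ∈ candidates b S, sbmProb Λ φ G * meanAP φ S P =
      (∑ L ∈ Finset.univ.filter P, ∑ φ ∈ candidates b S,
        sbmProb Λ φ G * averagePrecision φ S L) / ((Finset.univ.filter P).card : ℝ) := by
    intro P
    rw [Finset.sum_comm, Finset.sum_div]
    refine Finset.sum_congr rfl fun φ _ => ?_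
    unfold meanAP
    rw [← mul_div_assoc, Finset.mul_sum]
  obtain ⟨L₀, hL₀⟩ := exists_isCanonicalList Λ b G S
  set V : NominationList S → ℝ := fun L =>
    ∑ φ ∈ candidates b S, sbmProb Λ φ G * averagePrecision φ S L with hV
  have hVle : ∀ L L', IsCanonicalList Λ b G S L' → V L ≤ V L' := fun L L' h =>
    sum_candidates_averagePrecision_le hΛ h L
  have hV0 : 0 ≤ V L₀ := Finset.sum_nonneg fun φ _ =>
    mul_nonneg (sbmProb_nonneg hΛ φ G) (averagePrecision_nonneg φ S L₀)
  rw [hswap, hswap]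
  calc _ ≤ V L₀ := by
        refine div_le_of_le_mul₀ (by positivity) hV0 ?_
        rw [mul_comm, ← nsmul_eq_mul]
        exact Finset.sum_le_card_nsmul _ _ _ fun L _ => hVle L L₀ hL₀
    _ ≤ _ := by
        rw [le_div_iff₀, mul_comm, ← nsmul_eq_mul]
        · exact Finset.card_nsmul_le_sum _ _ _ fun L hL => hVle L₀ L (Finset.mem_filter.1 hL).2
        · have : 0 < (Finset.univ.filter (IsCanonicalList Λ b G S)).card :=
            Finset.card_pos.2 ⟨L₀, by simpa using hL₀⟩
          exact_mod_cast this

/-! ### Invariance under relabelling the vertices -/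

theorem sbmProb_comp_perm {Λ : Matrix (Fin K) (Fin K) ℝ} (hsymm : Λ.IsSymm)
    (σ : Equiv.Perm (Fin n)) (b : Fin n → Fin K) (G : SimpleGraph (Fin n)) :
    sbmProb Λ (b ∘ σ) (G.comap σ) = sbmProb Λ b G := by
  classical
  unfold sbmProb
  have hinv : ∀ (τ : Equiv.Perm (Fin n)) (p : Fin n × Fin n), p.1 < p.2 →
      increasingPair (τ.symm (increasingPair (τ p.1) (τ p.2)).1)
        (τ.symm (increasingPair (τ p.1) (τ p.2)).2) = p := by
    intro τ p hp
    by_cases h : τ p.1 < τ p.2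
    · simp only [increasingPair, h, if_true, Equiv.symm_apply_apply, hp]
    · simp only [increasingPair, h, if_false, Equiv.symm_apply_apply, hp.asymm]
  have hmem : ∀ (τ : Equiv.Perm (Fin n)) (p : Fin n × Fin n), p.1 < p.2 →
      (increasingPair (τ p.1) (τ p.2)).1 < (increasingPair (τ p.1) (τ p.2)).2 := by
    intro τ p hp
    simpa [vertexPairs] using increasingPair_mem (τ.injective.ne hp.ne)
  refine Finset.prod_bij' (fun p _ => increasingPair (σ p.1) (σ p.2))
    (fun p _ => increasingPair (σ.symm p.1) (σ.symm p.2)) ?_ ?_ ?_ ?_ ?_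
  · intro p hp
    simpa using hmem σ p (by simpa using hp)
  · intro p hp
    simpa using hmem σ.symm p (by simpa using hp)
  · intro p hp
    exact hinv σ p (by simpa using hp)
  · intro p hp
    exact hinv σ.symm p (by simpa using hp)
  · intro p _
    simp only [SimpleGraph.comap_adj, Function.comp_apply, increasingPair]
    split_ifs <;> simp_all [G.adj_comm, hsymm.apply]

theorem blockSize_comp_perm (σ : Equiv.Perm (Fin n)) (b : Fin n → Fin K) :
    blockSize (b ∘ σ) = blockSize b := by
  funext k
  exact Finset.card_equiv σ (by simp)

theorem feasible_comp_perm_iff (σ : Equiv.Perm (Fin n)) {N : Fin K → ℕ} {b φ : Fin n → Fin K}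
    {S : Finset (Fin n)} :
    Feasible N (b ∘ σ) (S.map σ.symm.toEmbedding) (φ ∘ σ) ↔ Feasible N b S φ := by
  unfold Feasible
  rw [blockSize_comp_perm]
  refine and_congr_right fun _ => ?_
  simp only [Finset.mem_map_equiv, Equiv.symm_symm, Function.comp_apply]
  exact σ.forall_congr_right (q := fun i => i ∈ S → φ i = b i)

theorem posterior_comp_perm [NeZero K] {Λ : Matrix (Fin K) (Fin K) ℝ} (hsymm : Λ.IsSymm)
    (σ : Equiv.Perm (Fin n)) (b : Fin n → Fin K) (G : SimpleGraph (Fin n)) (S : Finset (Fin n))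
    (v : Fin n) : posterior Λ (b ∘ σ) (G.comap σ) (S.map σ.symm.toEmbedding) v =
      posterior Λ b G S (σ v) := by
  classical
  unfold posterior
  rw [blockSize_comp_perm]
  congr 1
  · refine (Finset.sum_equiv (σ.symm.arrowCongr (Equiv.refl (Fin K))) ?_ ?_).symm
    · intro φ
      have := feasible_comp_perm_iff σ (N := blockSize b) (b := b) (φ := φ) (S := S)
      simp only [Finset.mem_filter, Finset.mem_univ, true_and]
      exact and_congr this.symm Iff.rfl
    · intro φ _
      exact (sbmProb_comp_perm hsymm σ φ G).symm
  · refine (Finset.sum_equiv (σ.symm.arrowCongr (Equiv.refl (Fin K))) ?_ ?_).symm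
    · intro φ
      have := feasible_comp_perm_iff σ (N := blockSize b) (b := b) (φ := φ) (S := S)
      simp only [Finset.mem_filter, Finset.mem_univ, true_and]
      exact this.symm
    · intro φ _
      exact (sbmProb_comp_perm hsymm σ φ G).symm

/-- The relabelling of the nonseeds by a permutation of the vertices. -/
def nonseedEquiv (σ : Equiv.Perm (Fin n)) (S : Finset (Fin n)) :
    {v : Fin n // v ∉ S.map σ.symm.toEmbedding} ≃ {v : Fin n // v ∉ S} :=
  σ.subtypeEquiv fun v => by simp

/-- The relabelling of nomination lists by a permutation of the vertices. -/
def listEquiv (σ : Equiv.Perm (Fin n)) (S : Finset (Fin n)) :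
    NominationList S ≃ NominationList (S.map σ.symm.toEmbedding) :=
  (nonseedEquiv σ S).symm.equivCongr (finCongr (Fintype.card_congr (nonseedEquiv σ S)).symm)

theorem listEquiv_apply_val (σ : Equiv.Perm (Fin n)) (S : Finset (Fin n)) (L : NominationList S)
    (v : {v : Fin n // v ∉ S.map σ.symm.toEmbedding}) :
    (listEquiv σ S L v : ℕ) = L (nonseedEquiv σ S v) := rfl

theorem averagePrecision_comp_perm [NeZero K] (σ : Equiv.Perm (Fin n)) (b : Fin n → Fin K)
    (S : Finset (Fin n)) (L : NominationList S) :
    averagePrecision (b ∘ σ) (S.map σ.symm.toEmbedding) (listEquiv σ S L) =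
      averagePrecision b S L := by
  classical
  have hu : targetCount (b ∘ σ) (S.map σ.symm.toEmbedding) = targetCount b S := by
    rw [targetCount_eq_card_subtype, targetCount_eq_card_subtype]
    refine Finset.card_equiv (nonseedEquiv σ S) fun v => ?_
    simp [nonseedEquiv]
  have hp : ∀ i, prefixHits (b ∘ σ) (S.map σ.symm.toEmbedding) (listEquiv σ S L) i =
      prefixHits b S L i := by
    intro i
    refine Finset.card_equiv (nonseedEquiv σ S) fun v => ?_
    rw [Finset.mem_filter, Finset.mem_filter]
    simp only [Finset.mem_univ, true_and, listEquiv_apply_val]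
    exact Iff.rfl
  rw [averagePrecision_eq, averagePrecision_eq, hu]
  simp_rw [hp]

theorem meanAP_comp_perm [NeZero K] (σ : Equiv.Perm (Fin n)) (b : Fin n → Fin K)
    (S : Finset (Fin n)) {P : NominationList S → Prop}
    {P' : NominationList (S.map σ.symm.toEmbedding) → Prop}
    (hP : ∀ L, P' (listEquiv σ S L) ↔ P L) :
    meanAP (b ∘ σ) (S.map σ.symm.toEmbedding) P' = meanAP b S P := by
  classical
  unfold meanAP
  congr 1
  · refine (Finset.sum_equiv (listEquiv σ S) (fun L => ?_) fun L _ => ?_).symm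
    · simp [hP]
    · exact (averagePrecision_comp_perm σ b S L).symm
  · congr 1
    exact (Finset.card_equiv (listEquiv σ S) fun L => by simp [hP]).symm

theorem isCanonicalList_comp_perm_iff [NeZero K] {Λ : Matrix (Fin K) (Fin K) ℝ}
    (hsymm : Λ.IsSymm) (σ : Equiv.Perm (Fin n)) (b : Fin n → Fin K) (G : SimpleGraph (Fin n))
    (S : Finset (Fin n)) (L : NominationList S) :
    IsCanonicalList Λ (b ∘ σ) (G.comap σ) (S.map σ.symm.toEmbedding) (listEquiv σ S L) ↔
      IsCanonicalList Λ b G S L := by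
  unfold IsCanonicalList
  simp_rw [posterior_comp_perm hsymm, Fin.lt_def, listEquiv_apply_val]
  rw [← (nonseedEquiv σ S).forall_congr_right]
  refine forall_congr' fun v => ?_
  rw [← (nonseedEquiv σ S).forall_congr_right]
  exact Iff.rfl

theorem canonicalEAP_comp_perm [NeZero K] {Λ : Matrix (Fin K) (Fin K) ℝ} (hsymm : Λ.IsSymm)
    (σ : Equiv.Perm (Fin n)) (b : Fin n → Fin K) (m : ℕ) :
    canonicalEAP Λ (b ∘ σ) m = canonicalEAP Λ b m := by
  classical
  unfold canonicalEAP expectation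
  symm
  refine Fintype.sum_equiv (Equiv.simpleGraph σ.symm) _ _ fun G => ?_
  refine Finset.sum_equiv (Equiv.finsetCongr σ.symm) (fun S => ?_) fun S _ => ?_
  · simp [Finset.mem_powersetCard]
  · change _ = sbmProb Λ (b ∘ σ) (G.comap σ) * _ *
      meanAP (b ∘ σ) (S.map σ.symm.toEmbedding) (IsCanonicalList Λ (b ∘ σ) (G.comap σ) _)
    rw [sbmProb_comp_perm hsymm,
      meanAP_comp_perm σ b S (isCanonicalList_comp_perm_iff hsymm σ b G S)]

theorem exists_perm_of_blockSize_eq {b b' : Fin n → Fin K} (h : blockSize b' = blockSize b) :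
    ∃ σ : Equiv.Perm (Fin n), b' = b ∘ σ := by
  classical
  have hcard : ∀ k, Fintype.card {v // b' v = k} = Fintype.card {v // b v = k} := by
    intro k
    rw [Fintype.card_subtype, Fintype.card_subtype]
    exact congrFun h k
  refine ⟨Equiv.ofFiberEquiv fun k => Fintype.equivOfCardEq (hcard k), ?_⟩
  funext v
  exact (Equiv.ofFiberEquiv_map _ v).symm

theorem canonicalEAP_congr [NeZero K] {Λ : Matrix (Fin K) (Fin K) ℝ} (hsymm : Λ.IsSymm)
    {b b' : Fin n → Fin K} (h : blockSize b' = blockSize b) (m : ℕ) :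
    canonicalEAP Λ b' m = canonicalEAP Λ b m := by
  obtain ⟨σ, rfl⟩ := exists_perm_of_blockSize_eq h
  exact canonicalEAP_comp_perm hsymm σ b m

/-- The canonical scheme does at least as well as the worst case of any scheme `Q` that, like it,
only knows the graph and the blocks of the seeds: by invariance, its performance can be averaged
over all assignments with the given block sizes, where Bayes optimality applies. -/
theorem le_canonicalEAP [NeZero K] {Λ : Matrix (Fin K) (Fin K) ℝ} (hsymm : Λ.IsSymm)
    (hΛ : ∀ k l, 0 < Λ k l ∧ Λ k l < 1) (b : Fin n → Fin K) (m : ℕ)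
    (Q : (Fin n → Fin K) → SimpleGraph (Fin n) → (S : Finset (Fin n)) → NominationList S → Prop)
    (hQ : ∀ b₁ b₂ G S, (∀ i ∈ S, b₁ i = b₂ i) → Q b₁ G S = Q b₂ G S) {a : ℝ}
    (ha : ∀ b', blockSize b' = blockSize b →
      a ≤ expectation Λ b' m fun G S => meanAP b' S (Q b' G S)) :
    a ≤ canonicalEAP Λ b m := by
  classical
  set O : Finset (Fin n → Fin K) := Finset.univ.filter fun b' => blockSize b' = blockSize b
    with hO
  have hmemO : ∀ b', b' ∈ O ↔ blockSize b' = blockSize b := fun b' => by simp [hO]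
  have hfix : ∀ G S, ∑ b' ∈ O, sbmProb Λ b' G * meanAP b' S (Q b' G S) ≤
      ∑ b' ∈ O, sbmProb Λ b' G * meanAP b' S (IsCanonicalList Λ b' G S) := by
    intro G S
    rw [← Finset.sum_fiberwise O (fun (b' : Fin n → Fin K) (i : {i // i ∈ S}) => b' i),
      ← Finset.sum_fiberwise O (fun (b' : Fin n → Fin K) (i : {i // i ∈ S}) => b' i)
        (fun b' => sbmProb Λ b' G * meanAP b' S (IsCanonicalList Λ b' G S))]
    -- The assignments with given restriction `r` to the seeds are indistinguishable for both
    -- schemes.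
    refine Finset.sum_le_sum fun r _ => ?_
    rcases (O.filter fun b' => (fun i : {i // i ∈ S} => b' i) = r).eq_empty_or_nonempty
      with h | ⟨b₀, hb₀⟩
    · rw [h]
      simp
    · rw [Finset.mem_filter, hmemO] at hb₀
      have hagree : ∀ b' : Fin n → Fin K, (fun i : {i // i ∈ S} => b' i) = r ↔ ∀ i ∈ S, b' i = b₀ i := by
        intro b'
        rw [← hb₀.2, funext_iff]
        exact Subtype.forall
      have hfib : (O.filter fun b' => (fun i : {i // i ∈ S} => b' i) = r) = candidates b₀ S := by
        ext b'
        rw [Finset.mem_filter, hmemO, mem_candidates, hagree, Feasible, hb₀.1, funext_iff]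
      rw [hfib]
      refine le_trans (le_of_eq ?_) ((sum_candidates_meanAP_le hΛ b₀ G S (Q b₀ G S)).trans
        (le_of_eq ?_))
      · refine Finset.sum_congr rfl fun b' hb' => ?_
        rw [hQ b' b₀ G S (mem_candidates.1 hb').2]
      · refine Finset.sum_congr rfl fun b' hb' => ?_
        have hf := mem_candidates.1 hb'
        have hfeas : ∀ φ, Feasible (blockSize b') b' S φ ↔ Feasible (blockSize b₀) b₀ S φ := by
          intro φ
          refine and_congr (forall_congr' fun k => by rw [hf.1 k])
            (forall₂_congr fun i hi => by rw [hf.2 i hi])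
        have hpost : ∀ v, posterior Λ b' G S v = posterior Λ b₀ G S v := by
          intro v
          unfold posterior
          simp_rw [hfeas]
        have : IsCanonicalList Λ b' G S = IsCanonicalList Λ b₀ G S := by
          funext L
          unfold IsCanonicalList
          simp_rw [hpost]
        rw [this]
  have hswap : ∀ F : (Fin n → Fin K) → SimpleGraph (Fin n) → Finset (Fin n) → ℝ,
      ∑ b' ∈ O, expectation Λ b' m (F b') = ∑ G : SimpleGraph (Fin n),
        ∑ S ∈ Finset.powersetCard m (Finset.univ : Finset (Fin n)),
          (1 / (n.choose m : ℝ)) * ∑ b' ∈ O, sbmProb Λ b' G * F b' G S := by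
    intro F
    unfold expectation
    rw [Finset.sum_comm]
    refine Finset.sum_congr rfl fun G _ => ?_
    rw [Finset.sum_comm]
    refine Finset.sum_congr rfl fun S _ => ?_
    rw [Finset.mul_sum]
    exact Finset.sum_congr rfl fun b' _ => by ring
  have hOpos : (0 : ℝ) < O.card := by
    have : 0 < O.card := Finset.card_pos.2 ⟨b, by rw [hmemO]⟩
    exact_mod_cast this
  refine le_of_mul_le_mul_left ?_ hOpos
  calc (O.card : ℝ) * a = O.card • a := (nsmul_eq_mul _ _).symm
    _ ≤ ∑ b' ∈ O, expectation Λ b' m fun G S => meanAP b' S (Q b' G S) :=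
        Finset.card_nsmul_le_sum _ _ _ fun b' hb' => ha b' ((hmemO b').1 hb')
    _ ≤ ∑ b' ∈ O, canonicalEAP Λ b' m := by
        unfold canonicalEAP
        rw [hswap fun b' G S => meanAP b' S (Q b' G S),
          hswap fun b' G S => meanAP b' S (IsCanonicalList Λ b' G S)]
        exact Finset.sum_le_sum fun G _ => Finset.sum_le_sum fun S _ =>
          mul_le_mul_of_nonneg_left (hfix G S) (by positivity)
    _ = (O.card : ℝ) * canonicalEAP Λ b m := by
        rw [Finset.sum_congr rfl fun b' hb' => canonicalEAP_congr hsymm ((hmemO b').1 hb') m,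
          Finset.sum_const, nsmul_eq_mul]

/-! ### Average precision of the two schemes -/

theorem BalancedSeeds.mul_card_compl_le_targetCount [NeZero K] {b : Fin n → Fin K}
    {S : Finset (Fin n)} {c δ : ℝ} (h : BalancedSeeds b S δ) (hδ : 0 ≤ δ) (hδc : δ ≤ c)
    (hn : 0 < n) (hb : 2 * c * n ≤ blockSize b 0) : c * Sᶜ.card ≤ targetCount b S := by
  have hn' : (0 : ℝ) < n := by exact_mod_cast hn
  have hu0 : (0 : ℝ) ≤ Sᶜ.card := by positivity
  have hm0 : (0 : ℝ) ≤ S.card := by positivity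
  have h1 : (targetCount b S : ℝ) + seedCount b S 0 = blockSize b 0 := by
    exact_mod_cast targetCount_add_seedCount b S
  have h2 : (S.card : ℝ) + Sᶜ.card = n := by
    have := Finset.card_add_card_compl S
    rw [Fintype.card_fin] at this
    exact_mod_cast this
  have h3 := (abs_le.1 (h 0)).2
  have h4 : δ * ((S.card : ℝ) * Sᶜ.card / n) ≤ c * Sᶜ.card := by
    have : (S.card : ℝ) * Sᶜ.card / n ≤ Sᶜ.card := by
      rw [div_le_iff₀ hn']
      nlinarith
    exact mul_le_mul hδc this (by positivity) (hδ.trans hδc)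
  have h5 : (blockSize b 0 : ℝ) - S.card * blockSize b 0 / n =
      blockSize b 0 / n * Sᶜ.card := by
    rw [← h2] at hn' ⊢
    field_simp
    ring
  have h6 : 2 * c * Sᶜ.card ≤ blockSize b 0 / n * Sᶜ.card := by
    gcongr
    rwa [le_div_iff₀ hn']
  linarith

theorem BalancedSeeds.one_sub_le_averagePrecision [NeZero K] {b : Fin n → Fin K}
    {S : Finset (Fin n)} {c δ η : ℝ} (h : BalancedSeeds b S δ) (hc : 0 < c) (hδ : 0 ≤ δ)
    (hδc : δ ≤ c) (hb : 2 * c * n ≤ blockSize b 0) (hu : 0 < Sᶜ.card)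
    {T : Fin n → Prop} (hT : (mismatchCount b S T : ℝ) ≤ η * (c * Sᶜ.card)) (hη : 0 ≤ η)
    {L : NominationList S} (hL : StartsWith S T L) : 1 - 2 * √η ≤ averagePrecision b S L := by
  have hn : 0 < n := hu.trans_le ((Finset.card_le_univ _).trans (by simp))
  have h1 := h.mul_card_compl_le_targetCount hδ hδc hn hb
  have hu' : (0 : ℝ) < Sᶜ.card := by exact_mod_cast hu
  have h2 : (0 : ℝ) < targetCount b S := (mul_pos hc hu').trans_le h1
  refine le_trans ?_ (VertexNomination.one_sub_le_averagePrecision hL (by exact_mod_cast h2))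
  have h3 : (mismatchCount b S T : ℝ) / targetCount b S ≤ η := by
    rw [div_le_iff₀ h2]
    exact hT.trans (by gcongr)
  have := Real.sqrt_le_sqrt h3
  linarith

theorem mismatchCount_le_card [NeZero K] {b : Fin n → Fin K} {S : Finset (Fin n)}
    {T : Fin n → Prop} {A : Finset (Fin n)}
    (h : ∀ v, v ∉ S → ¬(T v ↔ b v = 0) → v ∈ A) : mismatchCount b S T ≤ A.card := by
  classical
  refine Finset.card_le_card_of_injOn Subtype.val (fun v hv => ?_) Subtype.val_injective.injOn
  exact h v v.2 (by simpa using hv)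

/-- The estimated block sizes are close to the true ones if the seed set is balanced. -/
theorem IsEstimatedSizes.abs_sub_blockSize_le {b : Fin n → Fin K} {S : Finset (Fin n)} {N : Fin K → ℕ}
    (hN : IsEstimatedSizes b S N) {δ : ℝ} (h : BalancedSeeds b S δ) (hS : 0 < S.card)
    (k : Fin K) : |(N k : ℝ) - blockSize b k| ≤ 1 + δ * Sᶜ.card := by
  have hS' : (0 : ℝ) < S.card := by exact_mod_cast hS
  have hn' : (0 : ℝ) < n := by
    have : 0 < n := hS.trans_le ((Finset.card_le_univ _).trans (by simp))
    exact_mod_cast this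
  have h1 := hN.2 k
  have h2 : |(seedCount b S k : ℝ) * n / S.card - blockSize b k| ≤ δ * Sᶜ.card := by
    have h3 : (seedCount b S k : ℝ) * n / S.card - blockSize b k =
        ((seedCount b S k : ℝ) - S.card * blockSize b k / n) * (n / S.card) := by
      field_simp
    rw [h3, abs_mul, abs_of_pos (div_pos hn' hS')]
    calc _ ≤ δ * ((S.card : ℝ) * Sᶜ.card / n) * (n / S.card) := by
          gcongr
          exact h k
      _ = _ := by field_simp
  calc _ ≤ |(N k : ℝ) - (seedCount b S k : ℝ) * n / S.card| +
        |(seedCount b S k : ℝ) * n / S.card - blockSize b k| := abs_sub_le _ _ _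
    _ ≤ _ := add_le_add h1.le h2

/-- The restricted-focus scheme has mean average precision close to `1` as soon as there are many
seeds and many nonseeds. -/
theorem exists_le_restrictedEAP [NeZero K] {Λ : Matrix (Fin K) (Fin K) ℝ} (hsymm : Λ.IsSymm)
    (hΛ : ∀ k l, 0 < Λ k l ∧ Λ k l < 1) (hdist : ∀ k l, k ≠ l → Λ k k ≠ Λ k l) {c ζ : ℝ}
    (hc : 0 < c) (hζ : 0 < ζ) :
    ∃ R : ℕ, ∀ (n : ℕ) (b : Fin n → Fin K) (m : ℕ), (∀ k, 2 * c * n ≤ blockSize b k) →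
      R ≤ m → m + R ≤ n → ∀ φ, IsEstimatedRestrictedSelector b m φ →
      1 - ζ ≤ restrictedEAP Λ b m φ := by
  classical
  obtain ⟨ε, hε, A, hA, hmis⟩ := exists_card_misclassified_le hΛ hdist hc
  set η : ℝ := (ζ / 4) ^ 2 with hη
  have hη0 : 0 < η := by positivity
  -- The numbers of atypical vertices and of wrong labels forced by the estimated block sizes are
  -- at most `δ * u` and `K * (1 + δ * u) ≤ 2 * K * δ * u`.
  set δ : ℝ := min c (η * c / ((A + 1) * (1 + 2 * K))) with hδdef
  have hδ : 0 < δ := lt_min hc (by positivity)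
  have hδc : δ ≤ c := min_le_left _ _
  have hδA : A * (δ * (1 + 2 * K)) ≤ η * c := by
    have h1 : δ ≤ η * c / ((A + 1) * (1 + 2 * K)) := min_le_right _ _
    rw [le_div_iff₀ (by positivity)] at h1
    have h2 : 0 ≤ δ * (1 + 2 * K) := by positivity
    nlinarith
  obtain ⟨R₀, hR₀, hmain⟩ := exists_le_expectation hsymm hΛ hc hδ hδc hε hδ
    (half_pos hζ)
  obtain ⟨R₁, hR₁⟩ := exists_nat_ge (1 / δ)
  refine ⟨max R₀ R₁, fun n b m hb hRm hmR φ hφ => ?_⟩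
  have hfin := hmain n b m hb ((le_max_left _ _).trans hRm)
    ((Nat.add_le_add_left (le_max_left _ _) _).trans hmR)
    (fun G S => meanAP b S (IsRestrictedList (lambdaHat b G S) b G S (φ G S)))
    (fun G S => meanAP_nonneg _ _ _) ?_
  · unfold restrictedEAP
    linarith
  intro G S hSm hbal hcm hM hat
  have hm0 : 0 < S.card := by
    rw [hSm]
    exact hR₀.trans_le ((le_max_left _ _).trans hRm)
  have hucard : Sᶜ.card = n - m := by rw [Finset.card_compl, hSm, Fintype.card_fin]
  have hu : R₁ ≤ Sᶜ.card := by
    have := (Nat.add_le_add_left (le_max_right R₀ R₁) m).trans hmR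
    omega
  have hδu : 1 ≤ δ * Sᶜ.card := by
    have h1 : (R₁ : ℝ) ≤ Sᶜ.card := by exact_mod_cast hu
    have h2 := hR₁.trans h1
    rw [div_le_iff₀ hδ] at h2
    linarith
  have hu0 : 0 < Sᶜ.card := by
    have : (0 : ℝ) < Sᶜ.card := by
      by_contra! hcon
      nlinarith
    exact_mod_cast this
  obtain ⟨hnd, hcard⟩ := hmis _ hM
  obtain ⟨N, hN, hMLE⟩ := hφ G S hSm hnd
  have h1 := hcard n b G S N (φ G S) hm0 (by rwa [hSm]) hN.1 hMLE
  have hmm : (mismatchCount b S (fun v => φ G S v = 0) : ℝ) ≤ η * (c * Sᶜ.card) := by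
    calc (mismatchCount b S (fun v => φ G S v = 0) : ℝ)
        ≤ ((Sᶜ.filter fun v => φ G S v ≠ b v).card : ℝ) := by
          refine Nat.cast_le.2 (mismatchCount_le_card fun v hv hne => ?_)
          rw [Finset.mem_filter, Finset.mem_compl]
          refine ⟨hv, fun h => hne ?_⟩
          rw [h]
      _ ≤ _ := h1
      _ ≤ A * (δ * Sᶜ.card + ∑ k : Fin K, (1 + δ * Sᶜ.card)) := by
          gcongr with k
          exact hN.abs_sub_blockSize_le hbal hm0 k
      _ ≤ A * (δ * Sᶜ.card + ∑ k : Fin K, 2 * (δ * Sᶜ.card)) := by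
          gcongr with k
          linarith
      _ = A * (δ * (1 + 2 * K)) * Sᶜ.card := by
          simp only [Finset.sum_const, Finset.card_univ, Fintype.card_fin, nsmul_eq_mul]
          ring
      _ ≤ η * c * Sᶜ.card := by gcongr
      _ = _ := by ring
  refine le_meanAP (exists_isRestrictedList _ _ _ _ _) fun L hL => ?_
  have h2 := hbal.one_sub_le_averagePrecision hc hδ.le hδc (hb 0) hu0 hmm hη0.le
    (L := L) (fun v w hv hw => (hL v w).1 hv hw)
  rw [hη, Real.sqrt_sq (by positivity)] at h2
  linarith

/-- The frequencies of the edges from `v` to the seeds of every block are close to those expected of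
a vertex of the block of interest. Unlike `TypicalVertex`, this only involves the blocks of the
seeds. -/
def LooksLikeTarget [NeZero K] (Λ : Matrix (Fin K) (Fin K) ℝ) (b : Fin n → Fin K)
    (G : SimpleGraph (Fin n)) (S : Finset (Fin n)) (ε : ℝ) (v : Fin n) : Prop :=
  ∀ k, |(seedDegree b G S v k : ℝ) - Λ k 0 * seedCount b S k| ≤ ε * seedCount b S k

theorem LooksLikeTarget.congr [NeZero K] (Λ : Matrix (Fin K) (Fin K) ℝ) {b₁ b₂ : Fin n → Fin K}
    (G : SimpleGraph (Fin n)) {S : Finset (Fin n)} (h : ∀ i ∈ S, b₁ i = b₂ i) (ε : ℝ) :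
    LooksLikeTarget Λ b₁ G S ε = LooksLikeTarget Λ b₂ G S ε := by
  classical
  have h1 : ∀ k, seedCount b₁ S k = seedCount b₂ S k := by
    intro k
    unfold seedCount
    congr 1
    exact Finset.filter_congr fun i hi => by rw [h i hi]
  have h2 : ∀ v k, seedDegree b₁ G S v k = seedDegree b₂ G S v k := by
    intro v k
    unfold seedDegree
    congr 1
    exact Finset.filter_congr fun i hi => by rw [h i hi]
  funext v
  unfold LooksLikeTarget
  simp_rw [h1, h2]

/-- The canonical scheme has mean average precision close to `1` as soon as there are many seeds
and many nonseeds: it beats the scheme that starts with the vertices whose seed degrees look like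
those of the block of interest. -/
theorem exists_le_canonicalEAP [NeZero K] {Λ : Matrix (Fin K) (Fin K) ℝ} (hsymm : Λ.IsSymm)
    (hΛ : ∀ k l, 0 < Λ k l ∧ Λ k l < 1) (hdist : ∀ k l, k ≠ l → Λ k k ≠ Λ k l) {c ζ : ℝ}
    (hc : 0 < c) (hζ : 0 < ζ) :
    ∃ R : ℕ, ∀ (n : ℕ) (b : Fin n → Fin K) (m : ℕ), (∀ k, 2 * c * n ≤ blockSize b k) →
      R ≤ m → m + R ≤ n → 1 - ζ ≤ canonicalEAP Λ b m := by
  classical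
  have hε : ∀ᶠ ε in 𝓝[>] (0 : ℝ), ∀ l, l ≠ 0 → ε < |Λ l l - Λ l 0| / 2 := by
    rw [eventually_all]
    intro l
    by_cases h : l = 0
    · simp [h]
    · have h1 : 0 < |Λ l l - Λ l 0| / 2 := half_pos (abs_pos.2 (sub_ne_zero.2 (hdist l 0 h)))
      filter_upwards [Ioo_mem_nhdsGT h1] with ε hε _
      exact hε.2
  obtain ⟨ε, hε, hεpos⟩ := (hε.and self_mem_nhdsWithin).exists
  replace hεpos : 0 < ε := hεpos
  set η : ℝ := (ζ / 4) ^ 2 with hη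
  have hη0 : 0 < η := by positivity
  obtain ⟨R, hR, hmain⟩ := exists_le_expectation hsymm hΛ hc hc le_rfl hεpos
    (mul_pos hη0 hc) (half_pos hζ)
  refine ⟨R, fun n b m hb hRm hmR => ?_⟩
  refine le_canonicalEAP hsymm hΛ b m (fun b' G S => StartsWith S (LooksLikeTarget Λ b' G S ε))
    (fun b₁ b₂ G S h => by rw [LooksLikeTarget.congr Λ G h]) fun b' hb' => ?_
  rw [← hb'] at hb
  have hfin := hmain n b' m hb hRm hmR
    (fun G S => meanAP b' S (StartsWith S (LooksLikeTarget Λ b' G S ε)))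
    (fun G S => meanAP_nonneg _ _ _) ?_
  · linarith
  intro G S hSm hbal hcm _ hat
  have hm0 : (0 : ℝ) < m := by exact_mod_cast hR.trans_le hRm
  have hu0 : 0 < Sᶜ.card := by
    rw [Finset.card_compl, hSm, Fintype.card_fin]
    omega
  have hmm : (mismatchCount b' S (LooksLikeTarget Λ b' G S ε) : ℝ) ≤ η * (c * Sᶜ.card) := by
    rw [← mul_assoc]
    refine le_trans (Nat.cast_le.2 (mismatchCount_le_card fun v hv hiff => ?_)) hat
    rw [Finset.mem_filter, Finset.mem_compl]
    refine ⟨hv, fun htyp => hiff ⟨fun hlook => ?_, fun h k => by simpa [h] using htyp k⟩⟩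
    by_contra hne
    have hpos : (0 : ℝ) < seedCount b' S (b' v) := (mul_pos hc hm0).trans_le (hcm _)
    have h1 := htyp (b' v)
    have h2 := hlook (b' v)
    have h3 : |Λ (b' v) (b' v) - Λ (b' v) 0| * seedCount b' S (b' v) ≤
        2 * ε * seedCount b' S (b' v) := by
      have h4 := abs_sub_le (Λ (b' v) (b' v) * seedCount b' S (b' v))
        (seedDegree b' G S v (b' v)) (Λ (b' v) 0 * seedCount b' S (b' v))
      rw [abs_sub_comm (Λ (b' v) (b' v) * _) (seedDegree b' G S v (b' v) : ℝ), ← sub_mul, abs_mul, abs_of_pos hpos] at h4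
      linarith
    have h5 := le_of_mul_le_mul_right h3 hpos
    have h6 := hε (b' v) hne
    linarith
  refine le_meanAP (exists_startsWith _ _) fun L hL => ?_
  have h2 := hbal.one_sub_le_averagePrecision hc hc.le le_rfl (hb 0) hu0 hmm hη0.le hL
  rw [hη, Real.sqrt_sq (by positivity)] at h2
  linarith

/-! ### The asymptotic regime -/

theorem expectation_le_one {Λ : Matrix (Fin K) (Fin K) ℝ} (hΛ : ∀ k l, 0 < Λ k l ∧ Λ k l < 1)
    (b : Fin n → Fin K) {m : ℕ} (hm : m ≤ n) {f : SimpleGraph (Fin n) → Finset (Fin n) → ℝ}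
    (hf : ∀ G S, f G S ≤ 1) : expectation Λ b m f ≤ 1 := by
  rw [expectation_eq]
  refine (Finset.sum_le_sum fun S _ => mul_le_of_le_one_right (by positivity) ?_).trans
    (sum_powersetCard_one_div_choose hm).le
  rw [← sum_sbmProb Λ b]
  exact Finset.sum_le_sum fun G _ => mul_le_of_le_one_right (sbmProb_nonneg hΛ b G) (hf G S)

theorem seedProb_le_expectation {Λ : Matrix (Fin K) (Fin K) ℝ}
    (hΛ : ∀ k l, 0 < Λ k l ∧ Λ k l < 1) (b : Fin n → Fin K) (m : ℕ)
    {f : SimpleGraph (Fin n) → Finset (Fin n) → ℝ} (hf0 : ∀ G S, 0 ≤ f G S)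
    {E : Finset (Fin n) → Prop} (hf : ∀ G S, E S → 1 ≤ f G S) :
    seedProb n m E ≤ expectation Λ b m f := by
  classical
  rw [expectation_eq, seedProb, ← Finset.sum_boole, Finset.sum_div]
  refine Finset.sum_le_sum fun S _ => ?_
  rw [div_eq_mul_one_div, mul_comm]
  refine mul_le_mul_of_nonneg_left ?_ (by positivity)
  split_ifs with h
  · rw [← sum_sbmProb Λ b]
    exact Finset.sum_le_sum fun G _ => le_mul_of_one_le_right (sbmProb_nonneg hΛ b G) (hf G S h)
  · exact Finset.sum_nonneg fun G _ => mul_nonneg (sbmProb_nonneg hΛ b G) (hf0 G S)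

/-- If there is only one block, every list has average precision `1`. -/
theorem one_le_meanAP_of_subsingleton [NeZero K] [Subsingleton (Fin K)] {b : Fin n → Fin K}
    {S : Finset (Fin n)} (hS : ∃ v, v ∉ S ∧ b v = 0) {P : NominationList S → Prop}
    (hP : ∃ L, P L) : 1 ≤ meanAP b S P := by
  refine le_meanAP hP fun L _ => ?_
  have h1 : 0 < targetCount b S := by
    obtain ⟨v, hv, hbv⟩ := hS
    exact Finset.card_pos.2 ⟨v, by simp [hv, hbv]⟩
  have h2 : mismatchCount b S (fun _ => True) = 0 := by
    refine Nat.le_zero.1 (mismatchCount_le_card (A := ∅) fun v _ h => absurd ?_ h)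
    exact iff_of_true trivial (Subsingleton.elim _ _)
  have h3 := one_sub_le_averagePrecision (L := L) (T := fun _ => True)
    (fun _ _ _ h => absurd trivial h) h1
  rw [h2] at h3
  simpa using h3

theorem seedProb_le_one_sub {m : ℕ} (hm : m ≤ n) {E : Finset (Fin n) → Prop}
    {F : Finset (Finset (Fin n))} (hF : ∀ S ∈ F, S.card = m ∧ ¬E S) :
    seedProb n m E ≤ 1 - F.card / n.choose m := by
  classical
  have hpos : (0 : ℝ) < n.choose m := by exact_mod_cast Nat.choose_pos hm
  have h1 := Finset.card_filter_add_card_filter_not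
    (s := Finset.powersetCard m (Finset.univ : Finset (Fin n))) E
  rw [Finset.card_powersetCard, Finset.card_univ, Fintype.card_fin] at h1
  have h2 : F.card ≤ ((Finset.powersetCard m (Finset.univ : Finset (Fin n))).filter
      fun S => ¬E S).card := by
    refine Finset.card_le_card fun S hS => ?_
    rw [Finset.mem_filter, Finset.mem_powersetCard]
    exact ⟨⟨Finset.subset_univ _, (hF S hS).1⟩, (hF S hS).2⟩
  unfold seedProb
  rw [le_sub_iff_add_le, ← add_div, div_le_one hpos]
  have h3 : ((Finset.powersetCard m (Finset.univ : Finset (Fin n))).filter E).card + F.card ≤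
      n.choose m := by omega
  convert (Nat.cast_le (α := ℝ)).2 h3 using 1
  push_cast
  rfl

/-- If there are few nonseeds, then with a probability bounded from below none of them is in the
block of interest. -/
theorem seedProb_exists_target_le [NeZero K] {b : Fin n → Fin K} {k : Fin K} (hk : k ≠ 0) {c : ℝ}
    (hc : 0 < c) (hc1 : c ≤ 1) (hb : 2 * c * n ≤ blockSize b k) {m R : ℕ} (hm : m ≤ n)
    (hmR : n ≤ m + R) (hR : R ≤ c * n) :
    seedProb n m (fun S => ∃ v, v ∉ S ∧ b v = 0) ≤ 1 - c ^ R := by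
  classical
  set r := n - m with hr
  have hrR : r ≤ R := by omega
  have hchoose : n.choose m = n.choose r := (Nat.choose_symm hm).symm
  have hpos : (0 : ℝ) < n.choose r := by exact_mod_cast Nat.choose_pos (Nat.sub_le n m)
  set W : Finset (Fin n) := Finset.univ.filter fun v => b v ≠ 0 with hW
  have hWcard : blockSize b k ≤ W.card := by
    refine Finset.card_le_card fun v hv => ?_
    rw [Finset.mem_filter] at hv ⊢
    exact ⟨hv.1, hv.2.trans_ne hk⟩
  -- The nonseeds avoid the block of interest when they form an `r`-subset of its complement `W`.
  have hupper := seedProb_le_one_sub hm (E := fun S => ∃ v, v ∉ S ∧ b v = 0)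
    (F := (Finset.powersetCard r W).image compl) (fun S hS => by
      obtain ⟨T, hT, rfl⟩ := Finset.mem_image.1 hS
      rw [Finset.mem_powersetCard] at hT
      refine ⟨by rw [Finset.card_compl, Fintype.card_fin, hT.2]; omega, ?_⟩
      rintro ⟨v, hv, hbv⟩
      have := hT.1 (by simpa using hv)
      exact (Finset.mem_filter.1 this).2 hbv)
  rw [Finset.card_image_of_injective _ compl_injective, Finset.card_powersetCard,
    hchoose] at hupper
  have hlow : c ^ R * n.choose r ≤ W.card.choose r := by
    have h1 : c * n ≤ ((W.card + 1 - r : ℕ) : ℝ) := by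
      have h2 : (blockSize b k : ℝ) ≤ W.card := by exact_mod_cast hWcard
      have h3 : (r : ℝ) ≤ R := by exact_mod_cast hrR
      have h4 : (W.card : ℝ) + 1 ≤ ((W.card + 1 - r : ℕ) : ℝ) + r := by
        exact_mod_cast (by omega : W.card + 1 ≤ (W.card + 1 - r) + r)
      linarith
    calc c ^ R * n.choose r ≤ c ^ r * (n ^ r / r.factorial) :=
          mul_le_mul (pow_le_pow_of_le_one hc.le hc1 hrR) (Nat.choose_le_pow_div r n)
            hpos.le (by positivity)
      _ = (c * n) ^ r / r.factorial := by rw [mul_pow, mul_div_assoc]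
      _ ≤ ((W.card + 1 - r : ℕ) : ℝ) ^ r / r.factorial := by gcongr
      _ ≤ W.card.choose r := Nat.pow_le_choose r W.card
  have h5 : c ^ R ≤ (W.card.choose r : ℝ) / n.choose r := by rwa [le_div_iff₀ hpos]
  linarith

theorem eventually_le_seeds [NeZero K] {b : ∀ n : ℕ, Fin n → Fin K} {m : ℕ → ℕ}
    (hm1 : Tendsto (fun n : ℕ => seedProb n (m n) fun S =>
      1 * (n : ℝ) ^ (4 / 5 : ℝ) ≤ (seedCount (b n) S 0 : ℝ)) atTop (𝓝 1)) (R : ℕ) :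
    ∀ᶠ n in atTop, R ≤ m n := by
  classical
  have h1 : Tendsto (fun n : ℕ => (n : ℝ) ^ (4 / 5 : ℝ)) atTop atTop :=
    (tendsto_rpow_atTop (by norm_num)).comp tendsto_natCast_atTop_atTop
  filter_upwards [h1.eventually_ge_atTop (R : ℝ), hm1.eventually (lt_mem_nhds one_pos)]
    with n hn hpos
  unfold seedProb at hpos
  have h2 : ((Finset.powersetCard (m n) (Finset.univ : Finset (Fin n))).filter fun S =>
      1 * (n : ℝ) ^ (4 / 5 : ℝ) ≤ (seedCount (b n) S 0 : ℝ)).Nonempty := by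
    rw [Finset.nonempty_iff_ne_empty]
    intro h
    rw [h] at hpos
    simp at hpos
  obtain ⟨S, hS⟩ := h2
  rw [Finset.mem_filter, Finset.mem_powersetCard] at hS
  have h3 : seedCount (b n) S 0 ≤ m n := hS.1.2 ▸ Finset.card_filter_le _ _
  have h4 : (seedCount (b n) S 0 : ℝ) ≤ m n := by exact_mod_cast h3
  exact_mod_cast (by linarith [hS.2] : (R : ℝ) ≤ m n)

theorem exists_eventually_mul_le_blockSize {b : ∀ n : ℕ, Fin n → Fin K}
    (hn : ∀ k, (fun n : ℕ => (blockSize (b n) k : ℝ)) =Θ[atTop] fun n : ℕ => (n : ℝ)) :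
    ∃ c : ℝ, 0 < c ∧ c ≤ 1 ∧ ∀ᶠ n : ℕ in atTop, ∀ k, 2 * c * n ≤ blockSize (b n) k := by
  have h1 : ∀ k, ∃ C : ℝ, 0 < C ∧ ∀ᶠ n : ℕ in atTop, (n : ℝ) ≤ C * blockSize (b n) k := by
    intro k
    obtain ⟨C, hC, h⟩ := (hn k).2.exists_pos
    refine ⟨C, hC, ?_⟩
    filter_upwards [h.bound] with n hn
    simpa using hn
  choose C hC hCn using h1
  have h2 : ∀ᶠ c in 𝓝[>] (0 : ℝ), ∀ k, c < 1 / (2 * C k) := by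
    rw [eventually_all]
    intro k
    have := hC k
    filter_upwards [Ioo_mem_nhdsGT (show 0 < 1 / (2 * C k) by positivity)] with c hc
    exact hc.2
  obtain ⟨c, hc, hc1⟩ := (h2.and (Ioo_mem_nhdsGT one_pos)).exists
  refine ⟨c, hc1.1, hc1.2.le, ?_⟩
  filter_upwards [eventually_all.2 hCn] with n hn k
  have h3 := hn k
  have h4 := hc k
  have h5 := hC k
  rw [lt_div_iff₀ (by positivity)] at h4
  have h6 : (0 : ℝ) ≤ blockSize (b n) k := by positivity
  nlinarith [hc1.1]

theorem tendsto_one_of_eventually_one_sub_le {f : ℕ → ℝ} (h1 : ∀ n, f n ≤ 1)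
    (h2 : ∀ ζ > 0, ∀ᶠ n in atTop, 1 - ζ ≤ f n) : Tendsto f atTop (𝓝 1) := by
  rw [Metric.tendsto_nhds]
  intro ε hε
  filter_upwards [h2 (ε / 2) (half_pos hε)] with n hn
  rw [Real.dist_eq, abs_lt]
  constructor <;> linarith [h1 n]

end VertexNomination

end

theorem theorem4 {K : ℕ} [NeZero K]
    (Λ : Matrix (Fin K) (Fin K) ℝ) (hsymm : Λ.IsSymm)
    (hΛ : ∀ k l, 0 < Λ k l ∧ Λ k l < 1)
    (hdist : ∀ k l, k ≠ l → Λ k k ≠ Λ k l)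
    (b : ∀ n : ℕ, Fin n → Fin K)
    (m : ℕ → ℕ) (hm : ∀ n, m n ≤ n)
    (hn : ∀ k, (fun n : ℕ => (VertexNomination.blockSize (b n) k : ℝ)) =Θ[atTop]
      fun n : ℕ => (n : ℝ))
    (hmk : ∀ k, k ≠ 0 → ∀ C : ℝ, Tendsto
      (fun n : ℕ => VertexNomination.seedProb n (m n) fun S =>
        C * ((n : ℝ) ^ (2 / 3 : ℝ) * Real.log n) ≤ (VertexNomination.seedCount (b n) S k : ℝ))
      atTop (𝓝 1))
    (hm1 : ∀ C : ℝ, Tendsto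
      (fun n : ℕ => VertexNomination.seedProb n (m n) fun S =>
        C * (n : ℝ) ^ (4 / 5 : ℝ) ≤ (VertexNomination.seedCount (b n) S 0 : ℝ))
      atTop (𝓝 1))
    (hU : Tendsto
      (fun n : ℕ => VertexNomination.seedProb n (m n) fun S => ∃ v, v ∉ S ∧ b n v = 0)
      atTop (𝓝 1))
    (φ : ∀ n : ℕ, SimpleGraph (Fin n) → Finset (Fin n) → Fin n → Fin K)
    (hφ : ∀ n, VertexNomination.IsEstimatedRestrictedSelector (b n) (m n) (φ n)) :
    Tendsto (fun n => VertexNomination.restrictedEAP Λ (b n) (m n) (φ n)) atTop (𝓝 1) ∧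
    Tendsto (fun n => |VertexNomination.canonicalEAP Λ (b n) (m n) -
      VertexNomination.restrictedEAP Λ (b n) (m n) (φ n)|) atTop (𝓝 0) := by
  open VertexNomination in
  have hR1 : ∀ n, restrictedEAP Λ (b n) (m n) (φ n) ≤ 1 := fun n =>
    expectation_le_one hΛ (b n) (hm n) fun _ _ => meanAP_le_one _ _ _
  have hC1 : ∀ n, canonicalEAP Λ (b n) (m n) ≤ 1 := fun n =>
    expectation_le_one hΛ (b n) (hm n) fun _ _ => meanAP_le_one _ _ _
  suffices h : Tendsto (fun n => restrictedEAP Λ (b n) (m n) (φ n)) atTop (𝓝 1) ∧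
      Tendsto (fun n => canonicalEAP Λ (b n) (m n)) atTop (𝓝 1) by
    refine ⟨h.1, ?_⟩
    simpa using (h.2.sub h.1).abs
  by_cases hK : ∃ k : Fin K, k ≠ 0
  · obtain ⟨k, hk⟩ := hK
    obtain ⟨c, hc, hc1, hcn⟩ := exists_eventually_mul_le_blockSize hn
    have hseeds : ∀ R : ℕ, ∀ᶠ n in atTop, R ≤ m n := fun R => eventually_le_seeds (hm1 1) R
    have hnonseeds : ∀ R : ℕ, ∀ᶠ n in atTop, m n + R ≤ n := by
      intro R
      have h1 : Tendsto (fun n : ℕ => c * (n : ℝ)) atTop atTop :=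
        tendsto_natCast_atTop_atTop.const_mul_atTop hc
      filter_upwards [hcn, h1.eventually_ge_atTop (R : ℝ),
        hU.eventually (lt_mem_nhds (sub_lt_self 1 (pow_pos hc R)))] with n hb hR hlt
      by_contra! hcon
      exact absurd (seedProb_exists_target_le hk hc hc1 (hb k) (hm n) hcon.le hR) (not_le.2 hlt)
    constructor
    · refine tendsto_one_of_eventually_one_sub_le hR1 fun ζ hζ => ?_
      obtain ⟨R, hR⟩ := exists_le_restrictedEAP hsymm hΛ hdist hc hζ
      filter_upwards [hcn, hseeds R, hnonseeds R] with n h1 h2 h3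
      exact hR n (b n) (m n) h1 h2 h3 (φ n) (hφ n)
    · refine tendsto_one_of_eventually_one_sub_le hC1 fun ζ hζ => ?_
      obtain ⟨R, hR⟩ := exists_le_canonicalEAP hsymm hΛ hdist hc hζ
      filter_upwards [hcn, hseeds R, hnonseeds R] with n h1 h2 h3
      exact hR n (b n) (m n) h1 h2 h3
  · push Not at hK
    have : Subsingleton (Fin K) := ⟨fun x y => (hK x).trans (hK y).symm⟩
    constructor
    · exact tendsto_of_tendsto_of_tendsto_of_le_of_le hU tendsto_const_nhds
        (fun n => seedProb_le_expectation hΛ (b n) (m n) (fun _ _ => meanAP_nonneg _ _ _)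
          fun G S hS => one_le_meanAP_of_subsingleton hS (exists_isRestrictedList _ _ _ _ _)) hR1
    · exact tendsto_of_tendsto_of_tendsto_of_le_of_le hU tendsto_const_nhds
        (fun n => seedProb_le_expectation hΛ (b n) (m n) (fun _ _ => meanAP_nonneg _ _ _)
          fun G S hS => one_le_meanAP_of_subsingleton hS (exists_isCanonicalList _ _ _ _)) hC1
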